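/- Let $R$ be a commutative ring with identity, $C$ a group of prime order $p$, and $G$ a finite group; all groups below are finite. For a finite group $L$, a $C$-fibred $L$-set is a finite $(L\times C)$-set on which $C$ acts freely, and $RB_C^1(L)$ is the $R$-submodule of the Burnside ring $RB(L\times C)$ (with coefficients in $R$) generated by the classes of the $C$-fibred $L$-sets. For finite groups $G,H,K$, composition is the $R$-bilinear map $\circ: RB_C^1(G\times H)\times RB_C^1(H\times K)\to RB_C^1(G\times K)$ defined on fibred sets $T$, $Y$ by letting $T\circ Y$ be the set of those orbits of $T\times Y$ under the $(H\times C)$-action $(h,c)(x,y)=((h,c)x,(h,c^{-1})y)$ on which $C$ acts freely, where $(g,k,c)\in G\times K\times C$ acts by $(g,k,c)[x,y]=[(g,c)x,\,ky]$. With this product $RB_C^1(G\times G)$ is an $R$-algebra, with identity the class of $(G\times G\times C)/\{(g,g,1): g\in G\}$. Let $I(G)$ be its two-sided ideal spanned over $R$ by all $a\circ b$ with $a\in RB_C^1(G\times K)$, $b\in RB_C^1(K\times G)$ and $K$ a group with $|K|<|G|$, and put $\widehat{RB_C^1}(G)=RB_C^1(G\times G)/I(G)$. Let $\hat G=\mathrm{Hom}(G,C)\rtimes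 \mathrm{Out}(G)$ be the group of pairs $(t,\sigma)$ with product $(t_1,\sigma_1)(t_2,\sigma_2)=((t_1\circ\sigma_2)\,t_2,\ \sigma_1\sigma_2)$. Let $Y_G$ be the set of injective homomorphisms $\zeta:C\to Z(G)\cap\Phi(G)$, where $\Phi(G)$ is the Frattini subgroup, and let $\mathcal Y_G=\mathrm{Out}(G)\times Y_G$. On the $R$-module $R\mathcal Y_G\oplus R\hat G$ consider the $R$-bilinear product which on $R\hat G$ is that of the group algebra and for which, for $(\omega,\zeta),(\alpha,\chi)\in\mathcal Y_G$ and $(t,\sigma)\in\hat G$, $$(\omega,\zeta)(\alpha,\chi)=\begin{cases}(\omega\alpha,\ \omega\chi)&\text{if }\zeta=\omega\chi,\\ 0&\text{otherwise,}\end{cases}$$ $$(t,\sigma)(\omega,\zeta)=(\sigma s,\ \sigma\zeta),\qquad (\omega,\zeta)(t,\sigma)=(u,\ \zeta),$$ where $s$ and $u$ are the classes in $\mathrm{Out}(G)$ of the automorphisms $s(g)=\omega(g)\,\zeta(t(\omega(g)))$ and $u(g)=\omega(\sigma(g))\,\zeta(t(g))$ of $G$ (in these formulas outer automorphisms are replaced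 by representatives; the results do not depend on the choice). With this product $R\mathcal Y_G\oplus R\hat G$ is an $R$-algebra with identity. Then: i) If $p$ does not divide $|Z(G)|$, then $\widehat{RB_C^1}(G)$ is isomorphic, as an $R$-algebra, to the group algebra $R\hat G$. ii) If $p$ divides $|Z(G)|$, then $\widehat{RB_C^1}(G)$ is isomorphic, as an $R$-algebra, to $R\mathcal Y_G\oplus R\hat G$. -/

import Mathlib

universe u v

noncomputable section

namespace FibredBiset

/-! ### Finite `Γ`-sets and the Burnside ring -/

/-- A finite (left) `Γ`-set. -/
structure GSet (Γ : Type u) [Group Γ] : Type (u + 1) where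
  /-- The underlying set. -/
  carrier : Type u
  [finite : Finite carrier]
  [action : MulAction Γ carrier]

instance (Γ : Type u) [Group Γ] : CoeSort (GSet Γ) (Type u) := ⟨GSet.carrier⟩

attribute [instance] GSet.finite GSet.action

namespace GSet

variable {Γ : Type u} [Group Γ]

/-- Isomorphism of `Γ`-sets. -/
def Iso (X Y : GSet Γ) : Prop :=
  ∃ e : X ≃ Y, ∀ (a : Γ) (x : X), e (a • x) = a • e x

/-- Disjoint union of two `Γ`-sets. -/
abbrev disjUnion (X Y : GSet Γ) : GSet Γ := ⟨X ⊕ Y⟩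

/-- The transitive `Γ`-set `Γ / S`. -/
abbrev coset [Finite Γ] (S : Subgroup Γ) : GSet Γ := ⟨Γ ⧸ S⟩

/-- A way to produce isomorphisms: an equivariant relation that is the graph of a bijection. -/
theorem Iso.of_rel {X Y : GSet Γ} (P : X → Y → Prop)
    (tot : ∀ x, ∃ y, P x y) (surj : ∀ y, ∃ x, P x y)
    (h : ∀ x y x' y', P x y → P x' y' → (x = x' ↔ y = y'))
    (eqv : ∀ (a : Γ) x y, P x y → P (a • x) (a • y)) : Iso X Y := by
  choose f hf using tot
  refine ⟨Equiv.ofBijective f ⟨fun x x' hx => (h _ _ _ _ (hf x) (hf x')).2 hx, fun y => ?_⟩,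
    fun a x => ?_⟩
  · obtain ⟨x, hx⟩ := surj y
    exact ⟨x, (h _ _ _ _ (hf x) hx).1 rfl⟩
  · exact (h _ _ _ _ (hf _) (eqv a _ _ (hf x))).1 rfl

theorem Iso.symm {X Y : GSet Γ} : Iso X Y → Iso Y X := by
  rintro ⟨e, he⟩
  refine ⟨e.symm, fun a y => ?_⟩
  rw [Equiv.symm_apply_eq, he, Equiv.apply_symm_apply]

theorem Iso.trans {X Y Z : GSet Γ} : Iso X Y → Iso Y Z → Iso X Z := by
  rintro ⟨e, he⟩ ⟨f, hf⟩
  exact ⟨e.trans f, fun a x => by simp [he, hf]⟩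

theorem Iso.refl (X : GSet Γ) : Iso X X := ⟨Equiv.refl _, fun _ _ => rfl⟩

end GSet

section Burnside

variable (R : Type v) [CommRing R] (Γ : Type u) [Group Γ]

/-- The defining relations of the Burnside ring: isomorphic `Γ`-sets are identified, and
disjoint union becomes addition. -/
def burnsideRel : Set (GSet Γ →₀ R) :=
  {r | ∃ X Y : GSet Γ, X.Iso Y ∧ r = Finsupp.single X 1 - Finsupp.single Y 1} ∪
  {r | ∃ X Y : GSet Γ,
    r = Finsupp.single (X.disjUnion Y) 1 - (Finsupp.single X 1 + Finsupp.single Y 1)}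

/-- `R B(Γ)`, the Burnside group of `Γ` with coefficients in `R`: the Grothendieck group of finite
`Γ`-sets with respect to disjoint union, extended to `R`. -/
abbrev Burnside : Type (max (u + 1) v) :=
  (GSet Γ →₀ R) ⧸ Submodule.span R (burnsideRel R Γ)

variable {Γ}

/-- The class of a finite `Γ`-set in the Burnside ring. -/
def cls (X : GSet Γ) : Burnside R Γ :=
  Submodule.Quotient.mk (Finsupp.single X 1)

theorem cls_iso {X Y : GSet Γ} (h : X.Iso Y) : cls R X = cls R Y :=
  (Submodule.Quotient.eq _).2 (Submodule.subset_span (Or.inl ⟨X, Y, h, rfl⟩))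

theorem cls_disjUnion (X Y : GSet Γ) : cls R (X.disjUnion Y) = cls R X + cls R Y :=
  (Submodule.Quotient.eq _).2 (Submodule.subset_span (Or.inr ⟨X, Y, rfl⟩))

variable {R}

/-- A function on finite `Γ`-sets that is constant on isomorphism classes and additive extends
linearly to the Burnside group. -/
def burnsideLift {M : Type*} [AddCommGroup M] [Module R M] (f : GSet Γ → M)
    (hiso : ∀ X Y : GSet Γ, X.Iso Y → f X = f Y)
    (hadd : ∀ X Y : GSet Γ, f (X.disjUnion Y) = f X + f Y) : Burnside R Γ →ₗ[R] M :=
  Submodule.liftQ _ (Finsupp.linearCombination R f) (by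
    rw [Submodule.span_le]
    rintro r (⟨X, Y, h, rfl⟩ | ⟨X, Y, rfl⟩)
    · simp [hiso X Y h]
    · simp [hadd X Y])

@[simp] theorem burnsideLift_cls {M : Type*} [AddCommGroup M] [Module R M] (f : GSet Γ → M)
    (hiso : ∀ X Y : GSet Γ, X.Iso Y → f X = f Y)
    (hadd : ∀ X Y : GSet Γ, f (X.disjUnion Y) = f X + f Y) (X : GSet Γ) :
    burnsideLift (R := R) f hiso hadd (cls R X) = f X := by
  simp [burnsideLift, cls]

theorem Burnside.induction {P : Burnside R Γ → Prop} (hc : ∀ X, P (cls R X)) (h0 : P 0)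
    (hadd : ∀ a b, P a → P b → P (a + b)) (hs : ∀ (r : R) a, P a → P (r • a)) (a) : P a := by
  obtain ⟨a, rfl⟩ := Submodule.Quotient.mk_surjective _ a
  induction a using Finsupp.induction_linear with
  | zero => exact h0
  | add f g hf hg => exact hadd _ _ hf hg
  | single X r =>
    have := hs r _ (hc X)
    rwa [cls, ← Submodule.Quotient.mk_smul, Finsupp.smul_single, smul_eq_mul, mul_one] at this

theorem Burnside.hom_ext {M : Type*} [AddCommGroup M] [Module R M]
    {f g : Burnside R Γ →ₗ[R] M} (h : ∀ X, f (cls R X) = g (cls R X)) : f = g := by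
  refine LinearMap.ext fun a => ?_
  induction a using Burnside.induction with
  | hc X => exact h X
  | h0 => simp
  | hadd a b ha hb => simp [ha, hb]
  | hs r a ha => simp [ha]

end Burnside

/-! ### Composition of `C`-fibred sets -/

section Comp

variable {C G H K L : Type u} [CommGroup C] [Group G] [Group H] [Group K] [Group L]

/-- `C`-freeness of a `(G × C)`-set: a finite `C`-free `(G × C)`-set is a `C`-fibred `G`-set. -/
def IsFibred (X : GSet (G × C)) : Prop :=
  ∀ (c : C) (x : X), ((1 : G), c) • x = x → c = 1

/-- `T × Y` modulo the action of `H × C` given by `(h, c) (t, y) = ((h, c) t, (h, c⁻¹) y)`. -/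
def orbSetoid (T : GSet ((G × H) × C)) (Y : GSet ((H × K) × C)) : Setoid (T × Y) where
  r a b := ∃ (h : H) (c : C),
    (((1 : G), h), c) • a.1 = b.1 ∧ ((h, (1 : K)), c⁻¹) • a.2 = b.2
  iseqv := by
    refine ⟨fun a => ⟨1, 1, ?_, ?_⟩, ?_, ?_⟩
    · exact one_smul _ _
    · rw [inv_one]; exact one_smul _ _
    · rintro a b ⟨h, c, h1, h2⟩
      refine ⟨h⁻¹, c⁻¹, ?_, ?_⟩
      · rw [← h1, smul_smul]; convert one_smul ((G × H) × C) _; simp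
      · rw [← h2, smul_smul]; convert one_smul ((H × K) × C) _; simp
    · rintro a b d ⟨h, c, h1, h2⟩ ⟨h', c', h1', h2'⟩
      refine ⟨h' * h, c' * c, ?_, ?_⟩
      · rw [← h1', ← h1, smul_smul]; simp
      · rw [← h2', ← h2, smul_smul]; simp [mul_comm]

/-- The set of `(H × C)`-orbits of `T × Y`. -/
def Orb (T : GSet ((G × H) × C)) (Y : GSet ((H × K) × C)) : Type u := Quotient (orbSetoid T Y)

instance (T : GSet ((G × H) × C)) (Y : GSet ((H × K) × C)) : Finite (Orb T Y) :=
  inferInstanceAs (Finite (Quotient (orbSetoid T Y)))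

/-- The orbit of `(t, y)`. -/
def orb {T : GSet ((G × H) × C)} {Y : GSet ((H × K) × C)} (t : T) (y : Y) : Orb T Y :=
  Quotient.mk (orbSetoid T Y) (t, y)

theorem orb_eq_iff {T : GSet ((G × H) × C)} {Y : GSet ((H × K) × C)} {t t' : T} {y y' : Y} :
    orb t y = orb t' y' ↔ ∃ (h : H) (c : C),
      (((1 : G), h), c) • t = t' ∧ ((h, (1 : K)), c⁻¹) • y = y' :=
  Quotient.eq

theorem orb_surj {T : GSet ((G × H) × C)} {Y : GSet ((H × K) × C)} (w : Orb T Y) :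
    ∃ t y, orb t y = w := by
  obtain ⟨⟨t, y⟩, rfl⟩ := Quotient.exists_rep w
  exact ⟨t, y, rfl⟩

/-- The action of `(G × K) × C` on the orbits, `(g, k, c) [t, y] = [(g, 1, c) t, (1, k, 1) y]`. -/
instance orbAction (T : GSet ((G × H) × C)) (Y : GSet ((H × K) × C)) :
    MulAction ((G × K) × C) (Orb T Y) where
  smul a := Quotient.map
    (fun x => (((a.1.1, (1 : H)), a.2) • x.1, (((1 : H), a.1.2), (1 : C)) • x.2)) (by
      rintro x y ⟨h, c, h1, h2⟩
      refine ⟨h, c, ?_, ?_⟩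
      · simp only [← h1, smul_smul]; congr 1; simp [mul_comm]
      · simp only [← h2, smul_smul]; congr 1; simp)
  one_smul w := by
    obtain ⟨⟨t, y⟩, rfl⟩ := Quotient.exists_rep w
    refine congrArg (Quotient.mk _) (Prod.ext ?_ ?_)
    · exact one_smul _ _
    · exact one_smul _ _
  mul_smul a b w := by
    obtain ⟨⟨t, y⟩, rfl⟩ := Quotient.exists_rep w
    refine congrArg (Quotient.mk _) (Prod.ext ?_ ?_)
    · show _ • t = _ • _ • t
      rw [smul_smul]; simp
    · show _ • y = _ • _ • y
      rw [smul_smul]; simp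

theorem smul_orb {T : GSet ((G × H) × C)} {Y : GSet ((H × K) × C)} (a : (G × K) × C)
    (t : T) (y : Y) : a • orb t y =
      orb (((a.1.1, (1 : H)), a.2) • t) ((((1 : H), a.1.2), (1 : C)) • y) := rfl

/-- The `((G × K) × C)`-set of all `(H × C)`-orbits of `T × Y`. -/
abbrev orbSet (T : GSet ((G × H) × C)) (Y : GSet ((H × K) × C)) : GSet ((G × K) × C) := ⟨Orb T Y⟩

instance freeAction (X : GSet (G × C)) :
    MulAction (G × C) {x : X // ∀ c : C, ((1 : G), c) • x = x → c = 1} where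
  smul a w := ⟨a • w.1, fun c hc => w.2 c (by
    have : ((1 : G), c) * a = a * ((1 : G), c) := by
      ext <;> simp [mul_comm]
    rw [smul_smul, this, ← smul_smul] at hc
    exact smul_left_cancel a hc)⟩
  one_smul w := Subtype.ext (one_smul _ _)
  mul_smul a b w := Subtype.ext (mul_smul _ _ _)

/-- The `C`-free part of a `(G × C)`-set: the elements on whose `C`-orbit `C` acts freely. -/
abbrev freePart (X : GSet (G × C)) : GSet (G × C) :=
  ⟨{x : X // ∀ c : C, ((1 : G), c) • x = x → c = 1}⟩

/-- The composition `T ∘ Y`: take the `(H × C)`-orbits of `T × Y`, and then choose those on which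
`C` acts freely. -/
abbrev comp (T : GSet ((G × H) × C)) (Y : GSet ((H × K) × C)) : GSet ((G × K) × C) :=
  freePart (orbSet T Y)

theorem freePart_isFibred (X : GSet (G × C)) : IsFibred (freePart X) :=
  fun c w hc => w.2 c (congrArg Subtype.val hc)

theorem comp_isFibred (T : GSet ((G × H) × C)) (Y : GSet ((H × K) × C)) :
    IsFibred (comp T Y) := freePart_isFibred _

theorem freePart_iso_self {X : GSet (G × C)} (h : IsFibred X) : (freePart X).Iso X :=
  ⟨⟨Subtype.val, fun x => ⟨x, fun c hc => h c x hc⟩, fun _ => rfl, fun _ => rfl⟩, fun _ _ => rfl⟩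

theorem freePart_iso {X Y : GSet (G × C)} (h : X.Iso Y) : (freePart X).Iso (freePart Y) := by
  obtain ⟨e, he⟩ := h
  refine ⟨e.subtypeEquiv fun x => ?_, fun a x => Subtype.ext (he a x.1)⟩
  refine forall_congr' fun c => ?_
  rw [← he, e.apply_eq_iff_eq]

theorem freePart_disjUnion (X Y : GSet (G × C)) :
    (freePart (X.disjUnion Y)).Iso ((freePart X).disjUnion (freePart Y)) := by
  refine GSet.Iso.of_rel (fun a b => (∃ x, a.1 = Sum.inl x.1 ∧ b = Sum.inl x) ∨
    (∃ x, a.1 = Sum.inr x.1 ∧ b = Sum.inr x)) ?_ ?_ ?_ ?_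
  · rintro ⟨x | y, h⟩
    · exact ⟨_, Or.inl ⟨⟨x, fun c hc => h c (congrArg Sum.inl hc)⟩, rfl, rfl⟩⟩
    · exact ⟨_, Or.inr ⟨⟨y, fun c hc => h c (congrArg Sum.inr hc)⟩, rfl, rfl⟩⟩
  · rintro (x | x)
    · exact ⟨⟨Sum.inl x.1, fun c hc => x.2 c (Sum.inl.inj hc)⟩, Or.inl ⟨x, rfl, rfl⟩⟩
    · exact ⟨⟨Sum.inr x.1, fun c hc => x.2 c (Sum.inr.inj hc)⟩, Or.inr ⟨x, rfl, rfl⟩⟩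
  · rintro a b a' b' (⟨x, hx, rfl⟩ | ⟨x, hx, rfl⟩) (⟨x', hx', rfl⟩ | ⟨x', hx', rfl⟩)
    · rw [Subtype.ext_iff, hx, hx', Sum.inl.injEq, Sum.inl.injEq, Subtype.ext_iff]
    · rw [Subtype.ext_iff, hx, hx']; simp
    · rw [Subtype.ext_iff, hx, hx']; simp
    · rw [Subtype.ext_iff, hx, hx', Sum.inr.injEq, Sum.inr.injEq, Subtype.ext_iff]
  · rintro a w b (⟨x, hx, rfl⟩ | ⟨x, hx, rfl⟩)
    · exact Or.inl ⟨a • x, congrArg (a • ·) hx, rfl⟩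
    · exact Or.inr ⟨a • x, congrArg (a • ·) hx, rfl⟩

theorem orbSet_iso {T T' : GSet ((G × H) × C)} {Y Y' : GSet ((H × K) × C)}
    (hT : T.Iso T') (hY : Y.Iso Y') : (orbSet T Y).Iso (orbSet T' Y') := by
  obtain ⟨e, he⟩ := hT
  obtain ⟨f, hf⟩ := hY
  refine GSet.Iso.of_rel (fun (a : Orb T Y) (b : Orb T' Y') =>
    ∃ t y, a = orb t y ∧ b = orb (e t) (f y)) ?_ ?_ ?_ ?_
  · intro w
    obtain ⟨t, y, rfl⟩ := orb_surj w
    exact ⟨_, t, y, rfl, rfl⟩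
  · intro w
    obtain ⟨t, y, rfl⟩ := orb_surj w
    exact ⟨_, e.symm t, f.symm y, rfl, by simp⟩
  · rintro _ _ _ _ ⟨t, y, rfl, rfl⟩ ⟨t', y', rfl, rfl⟩
    simp only [orb_eq_iff, ← he, ← hf, e.apply_eq_iff_eq, f.apply_eq_iff_eq]
  · rintro a _ _ ⟨t, y, rfl, rfl⟩
    exact ⟨_, _, rfl, by rw [he, hf]; rfl⟩

theorem orbSet_disjUnion_left (T T' : GSet ((G × H) × C)) (Y : GSet ((H × K) × C)) :
    (orbSet (T.disjUnion T') Y).Iso ((orbSet T Y).disjUnion (orbSet T' Y)) := by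
  refine GSet.Iso.of_rel (fun (a : Orb (T.disjUnion T') Y) (b : Orb T Y ⊕ Orb T' Y) =>
    (∃ (t : T) (y : Y), a = orb (T := T.disjUnion T') (Sum.inl t) y ∧ b = Sum.inl (orb t y)) ∨
    (∃ (t : T') (y : Y), a = orb (T := T.disjUnion T') (Sum.inr t) y ∧ b = Sum.inr (orb t y)))
    ?_ ?_ ?_ ?_
  · intro w
    obtain ⟨t | t, y, rfl⟩ := orb_surj w
    · exact ⟨_, Or.inl ⟨t, y, rfl, rfl⟩⟩
    · exact ⟨_, Or.inr ⟨t, y, rfl, rfl⟩⟩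
  · rintro (w | w)
    · obtain ⟨t, y, rfl⟩ := orb_surj w
      exact ⟨_, Or.inl ⟨t, y, rfl, rfl⟩⟩
    · obtain ⟨t, y, rfl⟩ := orb_surj w
      exact ⟨_, Or.inr ⟨t, y, rfl, rfl⟩⟩
  · rintro _ _ _ _ (⟨t, y, rfl, rfl⟩ | ⟨t, y, rfl, rfl⟩) (⟨t', y', rfl, rfl⟩ | ⟨t', y', rfl, rfl⟩)
    · rw [Sum.inl.injEq, orb_eq_iff, orb_eq_iff]
      exact exists₂_congr fun h c => and_congr Sum.inl_injective.eq_iff Iff.rfl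
    · simp only [reduceCtorEq, iff_false, orb_eq_iff]
      rintro ⟨h, c, h1, -⟩
      exact Sum.inl_ne_inr h1
    · simp only [reduceCtorEq, iff_false, orb_eq_iff]
      rintro ⟨h, c, h1, -⟩
      exact Sum.inr_ne_inl h1
    · rw [Sum.inr.injEq, orb_eq_iff, orb_eq_iff]
      exact exists₂_congr fun h c => and_congr Sum.inr_injective.eq_iff Iff.rfl
  · rintro a _ _ (⟨t, y, rfl, rfl⟩ | ⟨t, y, rfl, rfl⟩)
    · exact Or.inl ⟨_, _, rfl, rfl⟩
    · exact Or.inr ⟨_, _, rfl, rfl⟩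

theorem orbSet_disjUnion_right (T : GSet ((G × H) × C)) (Y Y' : GSet ((H × K) × C)) :
    (orbSet T (Y.disjUnion Y')).Iso ((orbSet T Y).disjUnion (orbSet T Y')) := by
  refine GSet.Iso.of_rel (fun (a : Orb T (Y.disjUnion Y')) (b : Orb T Y ⊕ Orb T Y') =>
    (∃ (t : T) (y : Y), a = orb (Y := Y.disjUnion Y') t (Sum.inl y) ∧ b = Sum.inl (orb t y)) ∨
    (∃ (t : T) (y : Y'), a = orb (Y := Y.disjUnion Y') t (Sum.inr y) ∧ b = Sum.inr (orb t y)))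
    ?_ ?_ ?_ ?_
  · intro w
    obtain ⟨t, y | y, rfl⟩ := orb_surj w
    · exact ⟨_, Or.inl ⟨t, y, rfl, rfl⟩⟩
    · exact ⟨_, Or.inr ⟨t, y, rfl, rfl⟩⟩
  · rintro (w | w)
    · obtain ⟨t, y, rfl⟩ := orb_surj w
      exact ⟨_, Or.inl ⟨t, y, rfl, rfl⟩⟩
    · obtain ⟨t, y, rfl⟩ := orb_surj w
      exact ⟨_, Or.inr ⟨t, y, rfl, rfl⟩⟩
  · rintro _ _ _ _ (⟨t, y, rfl, rfl⟩ | ⟨t, y, rfl, rfl⟩) (⟨t', y', rfl, rfl⟩ | ⟨t', y', rfl, rfl⟩)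
    · rw [Sum.inl.injEq, orb_eq_iff, orb_eq_iff]
      exact exists₂_congr fun h c => and_congr Iff.rfl Sum.inl_injective.eq_iff
    · simp only [reduceCtorEq, iff_false, orb_eq_iff]
      rintro ⟨h, c, -, h1⟩
      exact Sum.inl_ne_inr h1
    · simp only [reduceCtorEq, iff_false, orb_eq_iff]
      rintro ⟨h, c, -, h1⟩
      exact Sum.inr_ne_inl h1
    · rw [Sum.inr.injEq, orb_eq_iff, orb_eq_iff]
      exact exists₂_congr fun h c => and_congr Iff.rfl Sum.inr_injective.eq_iff
  · rintro a _ _ (⟨t, y, rfl, rfl⟩ | ⟨t, y, rfl, rfl⟩)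
    · exact Or.inl ⟨_, _, rfl, rfl⟩
    · exact Or.inr ⟨_, _, rfl, rfl⟩

theorem orbSet_assoc (T : GSet ((G × H) × C)) (Y : GSet ((H × K) × C)) (Z : GSet ((K × L) × C)) :
    (orbSet (orbSet T Y) Z).Iso (orbSet T (orbSet Y Z)) := by
  refine GSet.Iso.of_rel (fun (a : Orb (orbSet T Y) Z) (b : Orb T (orbSet Y Z)) =>
    ∃ (t : T) (y : Y) (z : Z), a = orb (T := orbSet T Y) (orb t y) z ∧
      b = orb (Y := orbSet Y Z) t (orb y z)) ?_ ?_ ?_ ?_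
  · intro w
    obtain ⟨w, z, rfl⟩ := orb_surj w
    obtain ⟨t, y, rfl⟩ := orb_surj w
    exact ⟨_, t, y, z, rfl, rfl⟩
  · intro w
    obtain ⟨t, w, rfl⟩ := orb_surj w
    obtain ⟨y, z, rfl⟩ := orb_surj w
    exact ⟨_, t, y, z, rfl, rfl⟩
  · rintro _ _ _ _ ⟨t, y, z, rfl, rfl⟩ ⟨t', y', z', rfl, rfl⟩
    rw [orb_eq_iff, orb_eq_iff]
    constructor
    · rintro ⟨k, c, h1, rfl⟩
      obtain ⟨h, d, rfl, rfl⟩ := orb_eq_iff.1 h1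
      refine ⟨h, d * c, ?_, orb_eq_iff.2 ⟨k, c, ?_, ?_⟩⟩
      · simp [smul_smul]
      · simp [smul_smul]
      · simp [smul_smul]
    · rintro ⟨h, d, rfl, h1⟩
      obtain ⟨k, c, rfl, h2⟩ := orb_eq_iff.1 h1
      refine ⟨k, c, orb_eq_iff.2 ⟨h, d * c⁻¹, ?_, ?_⟩, ?_⟩
      · simp [smul_smul]
      · simp [smul_smul]
      · rw [← h2]; simp [smul_smul]
  · rintro a _ _ ⟨t, y, z, rfl, rfl⟩
    refine ⟨(((a.1.1, 1), a.2) : (G × H) × C) • t, y, (((1, a.1.2), 1) : (K × L) × C) • z, ?_, ?_⟩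
    · show orb _ _ = orb _ _
      congr 1
      show orb _ _ = orb _ _
      congr 1
      exact one_smul _ _
    · show orb _ _ = orb _ _
      congr 1
      show orb _ _ = orb _ _
      congr 1
      exact one_smul _ _

theorem comp_freePart_left (W : GSet ((G × H) × C)) (Z : GSet ((H × K) × C)) :
    (comp (freePart W) Z).Iso (comp W Z) := by
  refine GSet.Iso.of_rel (fun a b => ∃ (w : freePart W) (z : Z),
    a.1 = orb w z ∧ b.1 = orb w.1 z) ?_ ?_ ?_ ?_
  · rintro ⟨q, hq⟩
    obtain ⟨w, z, rfl⟩ := orb_surj q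
    refine ⟨⟨orb w.1 z, fun c hc => hq c ?_⟩, w, z, rfl, rfl⟩
    obtain ⟨h, d, h1, h2⟩ := orb_eq_iff.1 hc
    exact orb_eq_iff.2 ⟨h, d, Subtype.ext h1, h2⟩
  · rintro ⟨q, hq⟩
    obtain ⟨w, z, rfl⟩ := orb_surj q
    have hw : ∀ c : C, ((1 : G × H), c) • w = w → c = 1 := by
      intro c hc
      refine hq c ?_
      show orb _ _ = _
      refine congr (congrArg orb hc) (one_smul _ _)
    refine ⟨⟨orb (T := freePart W) ⟨w, hw⟩ z, fun c hc => hq c ?_⟩, ⟨w, hw⟩, z, rfl, rfl⟩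
    obtain ⟨h, d, h1, h2⟩ := orb_eq_iff.1 hc
    exact orb_eq_iff.2 ⟨h, d, congrArg Subtype.val h1, h2⟩
  · rintro ⟨_, _⟩ ⟨_, _⟩ ⟨_, _⟩ ⟨_, _⟩ ⟨w, z, rfl, rfl⟩ ⟨w', z', rfl, rfl⟩
    rw [Subtype.mk_eq_mk, Subtype.mk_eq_mk, orb_eq_iff, orb_eq_iff]
    exact exists₂_congr fun h c => and_congr Subtype.ext_iff Iff.rfl
  · rintro a ⟨_, _⟩ ⟨_, _⟩ ⟨w, z, rfl, rfl⟩
    exact ⟨_, _, rfl, rfl⟩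

theorem comp_freePart_right (W : GSet ((G × H) × C)) (Z : GSet ((H × K) × C)) :
    (comp W (freePart Z)).Iso (comp W Z) := by
  refine GSet.Iso.of_rel (fun a b => ∃ (w : W) (z : freePart Z),
    a.1 = orb w z ∧ b.1 = orb w z.1) ?_ ?_ ?_ ?_
  · rintro ⟨q, hq⟩
    obtain ⟨w, z, rfl⟩ := orb_surj q
    refine ⟨⟨orb w z.1, fun c hc => hq c ?_⟩, w, z, rfl, rfl⟩
    obtain ⟨h, d, h1, h2⟩ := orb_eq_iff.1 hc
    exact orb_eq_iff.2 ⟨h, d, h1, Subtype.ext h2⟩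
  · rintro ⟨q, hq⟩
    obtain ⟨w, z, rfl⟩ := orb_surj q
    have hz : ∀ c : C, ((1 : H × K), c) • z = z → c = 1 := by
      intro c hc
      refine hq c ?_
      show orb _ _ = _
      refine Eq.symm (orb_eq_iff.2 ⟨1, c, ?_, ?_⟩)
      · rfl
      · have h1 : (((1 : H), (1 : K)), c⁻¹) • z = z := by
          rw [show (((1 : H), (1 : K)), c⁻¹) = (((1 : H × K), c) : (H × K) × C)⁻¹ by ext <;> simp,
            inv_smul_eq_iff, hc]
        exact h1.trans (one_smul ((H × K) × C) z).symm
    refine ⟨⟨orb (Y := freePart Z) w ⟨z, hz⟩, fun c hc => hq c ?_⟩, w, ⟨z, hz⟩, rfl, rfl⟩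
    obtain ⟨h, d, h1, h2⟩ := orb_eq_iff.1 hc
    exact orb_eq_iff.2 ⟨h, d, h1, congrArg Subtype.val h2⟩
  · rintro ⟨_, _⟩ ⟨_, _⟩ ⟨_, _⟩ ⟨_, _⟩ ⟨w, z, rfl, rfl⟩ ⟨w', z', rfl, rfl⟩
    rw [Subtype.mk_eq_mk, Subtype.mk_eq_mk, orb_eq_iff, orb_eq_iff]
    exact exists₂_congr fun h c => and_congr Iff.rfl Subtype.ext_iff
  · rintro a ⟨_, _⟩ ⟨_, _⟩ ⟨w, z, rfl, rfl⟩
    exact ⟨_, _, rfl, rfl⟩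

theorem comp_iso {T T' : GSet ((G × H) × C)} {Y Y' : GSet ((H × K) × C)}
    (hT : T.Iso T') (hY : Y.Iso Y') : (comp T Y).Iso (comp T' Y') :=
  freePart_iso (orbSet_iso hT hY)

theorem comp_assoc (T : GSet ((G × H) × C)) (Y : GSet ((H × K) × C)) (Z : GSet ((K × L) × C)) :
    (comp (comp T Y) Z).Iso (comp T (comp Y Z)) :=
  ((comp_freePart_left _ _).trans (freePart_iso (orbSet_assoc T Y Z))).trans
    (comp_freePart_right _ _).symm

/-- The diagonal subgroup `Δ(G) × 1` of `(G × G) × C`. -/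
def diag (C G : Type u) [CommGroup C] [Group G] : Subgroup ((G × G) × C) where
  carrier := {a | a.1.1 = a.1.2 ∧ a.2 = 1}
  one_mem' := ⟨rfl, rfl⟩
  mul_mem' := by
    rintro a b ⟨h1, h2⟩ ⟨h3, h4⟩
    exact ⟨by simp [h1, h3], by simp [h2, h4]⟩
  inv_mem' := by
    rintro a ⟨h1, h2⟩
    exact ⟨by simp [h1], by simp [h2]⟩

/-- The `C`-fibred `(G × G)`-set `C (G × G) / Δ(G)`. -/
abbrev unitSet (C G : Type u) [CommGroup C] [Group G] [Finite C] [Finite G] : GSet ((G × G) × C) :=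
  GSet.coset (diag C G)

theorem unitSet_isFibred [Finite C] [Finite G] : IsFibred (unitSet C G) := by
  intro c x hx
  obtain ⟨a, rfl⟩ := QuotientGroup.mk_surjective x
  have := QuotientGroup.eq.1 hx.symm
  simpa using this.2

theorem unitSet_eq_iff [Finite C] [Finite G] (a b : (G × G) × C) :
    ((QuotientGroup.mk a : ((G × G) × C) ⧸ diag C G) = QuotientGroup.mk b) ↔
      a.1.1⁻¹ * b.1.1 = a.1.2⁻¹ * b.1.2 ∧ a.2⁻¹ * b.2 = 1 :=
  QuotientGroup.eq

theorem orbSet_unit_left [Finite C] [Finite G] (Y : GSet ((G × K) × C)) :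
    (orbSet (unitSet C G) Y).Iso Y := by
  refine GSet.Iso.of_rel (fun (a : Orb (unitSet C G) Y) (b : Y) =>
    ∃ (g : G) (c : C) (y : Y), b = (((g, (1 : K)), c) : (G × K) × C) • y ∧
      a = orb (T := unitSet C G) (QuotientGroup.mk ((g, 1), c)) y) ?_ ?_ ?_ ?_
  · intro w
    obtain ⟨t, y, rfl⟩ := orb_surj w
    obtain ⟨⟨⟨g, h⟩, c⟩, rfl⟩ := QuotientGroup.mk_surjective t
    refine ⟨_, g * h⁻¹, c, y, rfl, ?_⟩
    congr 1
    rw [unitSet_eq_iff]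
    simp
  · intro y
    exact ⟨_, 1, 1, y, (one_smul _ _).symm, rfl⟩
  · rintro _ _ _ _ ⟨g, c, y, rfl, rfl⟩ ⟨g', c', y', rfl, rfl⟩
    rw [orb_eq_iff]
    constructor
    · rintro ⟨h, d, h1, rfl⟩
      obtain ⟨h2, h3⟩ := (unitSet_eq_iff _ _).1 h1
      simp only [smul_eq_mul, Prod.mk_mul_mk, one_mul, mul_one] at h2 h3
      have hg : g' = g * h⁻¹ := by rw [← h2]; group
      have hc : c' = d * c := by rw [inv_mul_eq_one] at h3; exact h3.symm
      simp [hg, hc, smul_smul]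
    · intro h
      refine ⟨g'⁻¹ * g, c' * c⁻¹, (unitSet_eq_iff _ _).2 ?_, ?_⟩
      · simp
      · have := congrArg ((((g', (1 : K)), c') : (G × K) × C)⁻¹ • ·) h
        simp only [inv_smul_smul] at this
        rw [← this, smul_smul]
        simp [mul_comm]
  · rintro a _ _ ⟨g, c, y, rfl, rfl⟩
    refine ⟨a.1.1 * g, a.2 * c, (((1 : G), a.1.2), (1 : C)) • y, ?_, ?_⟩
    · rw [smul_smul, smul_smul]
      congr 1
      ext <;> simp
    · show orb _ _ = orb _ _
      congr 1
      rw [MulAction.Quotient.smul_mk, unitSet_eq_iff]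
      simp

theorem orbSet_unit_right [Finite C] [Finite H] (T : GSet ((G × H) × C)) :
    (orbSet T (unitSet C H)).Iso T := by
  refine GSet.Iso.of_rel (fun (a : Orb T (unitSet C H)) (b : T) =>
    ∃ (k : H) (c : C) (t : T), b = ((((1 : G), k), c) : (G × H) × C) • t ∧
      a = orb (Y := unitSet C H) t (QuotientGroup.mk ((1, k), c))) ?_ ?_ ?_ ?_
  · intro w
    obtain ⟨t, y, rfl⟩ := orb_surj w
    obtain ⟨⟨⟨g, h⟩, c⟩, rfl⟩ := QuotientGroup.mk_surjective y
    refine ⟨_, h * g⁻¹, c, t, rfl, ?_⟩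
    congr 1
    rw [unitSet_eq_iff]
    simp
  · intro y
    exact ⟨_, 1, 1, y, (one_smul _ _).symm, rfl⟩
  · rintro _ _ _ _ ⟨g, c, y, rfl, rfl⟩ ⟨g', c', y', rfl, rfl⟩
    rw [orb_eq_iff]
    constructor
    · rintro ⟨h, d, rfl, h1⟩
      obtain ⟨h2, h3⟩ := (unitSet_eq_iff _ _).1 h1
      simp only [smul_eq_mul, Prod.mk_mul_mk, one_mul, mul_one] at h2 h3
      have hg : g' = g * h⁻¹ := by rw [h2]; group
      have hc : c' = d⁻¹ * c := by rw [inv_mul_eq_one] at h3; exact h3.symm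
      simp [hg, hc, smul_smul, mul_comm]
    · intro h
      refine ⟨g'⁻¹ * g, c * c'⁻¹, ?_, (unitSet_eq_iff _ _).2 ?_⟩
      · have := congrArg (((((1 : G), g'), c') : (G × H) × C)⁻¹ • ·) h
        simp only [inv_smul_smul] at this
        rw [← this, smul_smul]
        simp [mul_comm]
      · simp
  · rintro a _ _ ⟨k, c, t, rfl, rfl⟩
    refine ⟨a.1.2 * k, c, (((a.1.1, (1 : H)), a.2) : (G × H) × C) • t, ?_, ?_⟩
    · rw [smul_smul, smul_smul]
      congr 1
      ext <;> simp [mul_comm]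
    · show orb _ _ = orb _ _
      congr 1
      rw [MulAction.Quotient.smul_mk, unitSet_eq_iff]
      simp

theorem comp_unit_left [Finite C] [Finite G] {Y : GSet ((G × K) × C)} (h : IsFibred Y) :
    (comp (unitSet C G) Y).Iso Y :=
  (freePart_iso (orbSet_unit_left Y)).trans (freePart_iso_self h)

theorem comp_unit_right [Finite C] [Finite H] {T : GSet ((G × H) × C)} (h : IsFibred T) :
    (comp T (unitSet C H)).Iso T :=
  (freePart_iso (orbSet_unit_right T)).trans (freePart_iso_self h)

end Comp

/-! ### The monomial Burnside ring and the algebra `RB_C^1(G × G) / I(G)` -/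

section Monomial

variable (R : Type v) [CommRing R] (C G : Type u) [CommGroup C] [Group G]

/-- `RB_C^1(G)`, the monomial Burnside ring of `G` with coefficients in `C`: the submodule of
`RB(G × C)` generated by the classes of the `C`-fibred `G`-sets. -/
def MonomialBurnside : Submodule R (Burnside R (G × C)) :=
  Submodule.span R {b | ∃ X : GSet (G × C), IsFibred X ∧ b = cls R X}

variable {R C G} {H K L : Type u} [Group H] [Group K] [Group L]

/-- The bilinear extension of the composition `T ∘ Y`. -/
def compLin : Burnside R ((G × H) × C) →ₗ[R] Burnside R ((H × K) × C) →ₗ[R]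
    Burnside R ((G × K) × C) :=
  burnsideLift (fun T => burnsideLift (fun Y => cls R (comp T Y))
      (fun _ _ h => cls_iso R (comp_iso (GSet.Iso.refl T) h))
      (fun X Y => by
        rw [← cls_disjUnion]
        exact cls_iso R ((freePart_iso (orbSet_disjUnion_right T X Y)).trans
          (freePart_disjUnion _ _))))
    (fun T T' h => Burnside.hom_ext fun Y => by
      simpa using cls_iso R (comp_iso h (GSet.Iso.refl Y)))
    (fun T T' => Burnside.hom_ext fun Y => by
      simp only [burnsideLift_cls, LinearMap.add_apply]
      rw [← cls_disjUnion]
      exact cls_iso R ((freePart_iso (orbSet_disjUnion_left T T' Y)).trans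
          (freePart_disjUnion _ _)))

@[simp] theorem compLin_cls (T : GSet ((G × H) × C)) (Y : GSet ((H × K) × C)) :
    compLin (cls R T) (cls R Y) = cls R (comp T Y) := by
  simp [compLin]

theorem compLin_mem (a : Burnside R ((G × H) × C)) (b : Burnside R ((H × K) × C)) :
    compLin a b ∈ MonomialBurnside R C (G × K) := by
  induction a using Burnside.induction with
  | hc X =>
    induction b using Burnside.induction with
    | hc Y => rw [compLin_cls]; exact Submodule.subset_span ⟨_, comp_isFibred _ _, rfl⟩
    | h0 => simp
    | hadd a b ha hb => rw [map_add]; exact add_mem ha hb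
    | hs r a ha => rw [map_smul]; exact Submodule.smul_mem _ _ ha
  | h0 => simp
  | hadd a b ha hb => rw [map_add]; exact add_mem ha hb
  | hs r a ha => rw [map_smul]; exact Submodule.smul_mem _ _ ha

theorem compLin_assoc (a : Burnside R ((G × H) × C)) (b : Burnside R ((H × K) × C))
    (c : Burnside R ((K × L) × C)) :
    compLin (compLin a b) c = compLin a (compLin b c) := by
  induction a using Burnside.induction with
  | hc X =>
    induction b using Burnside.induction with
    | hc Y =>
      induction c using Burnside.induction with
      | hc Z => simpa using cls_iso R (comp_assoc X Y Z)
      | h0 => simp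
      | hadd a b ha hb => simp only [map_add, ha, hb]
      | hs r a ha => simp only [map_smul, ha]
    | h0 => simp
    | hadd a b ha hb => simp only [map_add, LinearMap.add_apply, ha, hb]
    | hs r a ha => simp only [map_smul, LinearMap.smul_apply, ha]
  | h0 => simp
  | hadd a b ha hb => simp only [map_add, LinearMap.add_apply, ha, hb]
  | hs r a ha => simp only [map_smul, LinearMap.smul_apply, ha]

/-- Composition in the category `P_{RB_C^1}`, as a bilinear map
`RB_C^1(G × H) × RB_C^1(H × K) → RB_C^1(G × K)`. -/
def mcomp (a : MonomialBurnside R C (G × H)) (b : MonomialBurnside R C (H × K)) :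
    MonomialBurnside R C (G × K) :=
  ⟨compLin a.1 b.1, compLin_mem _ _⟩

theorem compLin_unit_left [Finite C] [Finite G] (b : MonomialBurnside R C (G × K)) :
    compLin (cls R (unitSet C G)) b.1 = b.1 := by
  obtain ⟨b, hb⟩ := b
  induction hb using Submodule.span_induction with
  | mem x hx =>
    obtain ⟨X, hX, rfl⟩ := hx
    simpa using cls_iso R (comp_unit_left hX)
  | zero => simp
  | add x y _ _ hx hy => simp only [map_add] at *; rw [hx, hy]
  | smul r x _ hx => simp only [map_smul] at *; rw [hx]

theorem compLin_unit_right [Finite C] [Finite H] (b : MonomialBurnside R C (G × H)) :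
    compLin b.1 (cls R (unitSet C H)) = b.1 := by
  obtain ⟨b, hb⟩ := b
  induction hb using Submodule.span_induction with
  | mem x hx =>
    obtain ⟨X, hX, rfl⟩ := hx
    simpa using cls_iso R (comp_unit_right hX)
  | zero => simp
  | add x y _ _ hx hy => simp only [map_add, LinearMap.add_apply] at *; rw [hx, hy]
  | smul r x _ hx => simp only [map_smul, LinearMap.smul_apply] at *; rw [hx]

variable (R C G)

/-- `RB_C^1(G × G)`, as the endomorphism algebra of `G` in the category `P_{RB_C^1}`. -/
def EndAlg : Type (max (u + 1) v) := MonomialBurnside R C (G × G)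

namespace EndAlg

variable {R C G}

instance : AddCommGroup (EndAlg R C G) :=
  inferInstanceAs (AddCommGroup (MonomialBurnside R C (G × G)))

instance : Module R (EndAlg R C G) :=
  inferInstanceAs (Module R (MonomialBurnside R C (G × G)))

/-- The product of the endomorphism algebra is the composition. -/
instance : Mul (EndAlg R C G) := ⟨fun a b => mcomp (R := R) (C := C) (G := G) (H := G) (K := G) a b⟩

/-- The identity element is the class of `C (G × G) / Δ(G)`. -/
instance [Finite C] [Finite G] : One (EndAlg R C G) :=
  ⟨(⟨cls R (unitSet C G), Submodule.subset_span ⟨_, unitSet_isFibred, rfl⟩⟩ :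
    MonomialBurnside R C (G × G))⟩

instance [Finite C] [Finite G] : Ring (EndAlg R C G) :=
  { (inferInstance : AddCommGroup (EndAlg R C G)),
    (inferInstance : Mul (EndAlg R C G)),
    (inferInstance : One (EndAlg R C G)) with
    left_distrib := fun a b c => Subtype.ext (map_add (compLin a.1) b.1 c.1)
    right_distrib := fun a b c => Subtype.ext (LinearMap.map_add₂ compLin a.1 b.1 c.1)
    zero_mul := fun a => Subtype.ext (LinearMap.map_zero₂ compLin a.1)
    mul_zero := fun a => Subtype.ext (map_zero (compLin a.1))
    mul_assoc := fun a b c => Subtype.ext (compLin_assoc a.1 b.1 c.1)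
    one_mul := fun a => Subtype.ext (compLin_unit_left a)
    mul_one := fun a => Subtype.ext (compLin_unit_right a) }

instance [Finite C] [Finite G] : Algebra R (EndAlg R C G) :=
  Algebra.ofModule (fun r a b => Subtype.ext (LinearMap.map_smul₂ compLin r a.1 b.1))
    (fun r a b => Subtype.ext (map_smul (compLin a.1) r b.1))

end EndAlg

/-- The submodule `I(G)` of `RB_C^1(G × G)` generated by the elements `a ∘ b` with
`a ∈ RB_C^1(G × K)` and `b ∈ RB_C^1(K × G)` for some finite group `K` with `|K| < |G|`. -/
def factorSubmodule : Submodule R (EndAlg R C G) :=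
  Submodule.span R {x | ∃ (K : Type u) (_ : Group K) (_ : Finite K), Nat.card K < Nat.card G ∧
    ∃ (a : MonomialBurnside R C (G × K)) (b : MonomialBurnside R C (K × G)), x = mcomp a b}

variable [Finite C] [Finite G]

/-- The submodule `I(G)`, as a left ideal of `RB_C^1(G × G)`. -/
def factorIdeal : Ideal (EndAlg R C G) :=
  { (factorSubmodule R C G).toAddSubmonoid with
    smul_mem' := by
      intro c x hx
      change c * x ∈ factorSubmodule R C G
      change x ∈ factorSubmodule R C G at hx
      induction hx using Submodule.span_induction with
      | mem x hx =>
        obtain ⟨K, _, hK, hlt, a, b, rfl⟩ := hx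
        exact Submodule.subset_span ⟨K, _, hK, hlt,
          mcomp (R := R) (C := C) (G := G) (H := G) c a, b,
          Subtype.ext (compLin_assoc c.1 a.1 b.1).symm⟩
      | zero => rw [mul_zero]; exact zero_mem _
      | add x y _ _ hx hy => rw [mul_add]; exact add_mem hx hy
      | smul r x _ hx => rw [mul_smul_comm]; exact Submodule.smul_mem _ _ hx }

theorem mem_factorIdeal {x : EndAlg R C G} :
    x ∈ factorIdeal R C G ↔ x ∈ factorSubmodule R C G := Iff.rfl

instance : (factorIdeal R C G).IsTwoSided where
  mul_mem_of_left {x} c hx := by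
    rw [mem_factorIdeal] at *
    induction hx using Submodule.span_induction with
    | mem x hx =>
      obtain ⟨K, _, hK, hlt, a, b, rfl⟩ := hx
      exact Submodule.subset_span ⟨K, _, hK, hlt, a,
        mcomp (R := R) (C := C) (G := K) (H := G) b c,
        Subtype.ext (compLin_assoc a.1 b.1 c.1)⟩
    | zero => rw [zero_mul]; exact zero_mem _
    | add x y _ _ hx hy => rw [add_mul]; exact add_mem hx hy
    | smul r x _ hx => rw [smul_mul_assoc]; exact Submodule.smul_mem _ _ hx

/-- The `R`-algebra `RB_C^1(G × G) / I(G)`. -/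
abbrev HatAlg : Type (max (u + 1) v) := EndAlg R C G ⧸ factorIdeal R C G

end Monomial

/-! ### The group `Hom(G, C) ⋊ Out(G)` and the algebra `R𝒴_G ⊕ R Ĝ` -/

section Model

variable (R : Type v) [CommRing R] (C G : Type u) [CommGroup C] [Group G]

instance innerNormal : (MulAut.conj : G →* MulAut G).range.Normal where
  conj_mem := by
    rintro _ ⟨g, rfl⟩ σ
    exact ⟨σ g, by ext x; simp [MulAut.conj_apply]⟩

/-- `Out(G)`, the automorphisms of `G` modulo the inner ones. -/
abbrev Out : Type u := MulAut G ⧸ (MulAut.conj : G →* MulAut G).range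

variable {C G}

theorem out_mk_conj_mul (g : G) (w : MulAut G) :
    (QuotientGroup.mk (MulAut.conj g * w) : Out G) = QuotientGroup.mk w := by
  have h : (QuotientGroup.mk (MulAut.conj g) : Out G) = 1 :=
    (QuotientGroup.eq_one_iff _).2 (MonoidHom.mem_range.2 ⟨g, rfl⟩)
  rw [QuotientGroup.mk_mul, h, one_mul]

theorem out_exists_conj {w w' : MulAut G}
    (h : (QuotientGroup.mk w : Out G) = QuotientGroup.mk w') :
    ∃ g : G, w' = MulAut.conj g * w := by
  obtain ⟨g, hg⟩ := QuotientGroup.eq.1 h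
  refine ⟨w g, ?_⟩
  rw [show w' = w * MulAut.conj g by rw [hg]; group]
  ext x
  simp [MulAut.conj_apply]

/-- `t ∘ σ` for `t ∈ Hom(G, C)` and `σ ∈ Out(G)`. -/
def homComp (t : G →* C) (σ : Out G) : G →* C :=
  Quotient.liftOn' σ (fun w : MulAut G => t.comp w.toMonoidHom) (by
    intro w w' h
    obtain ⟨g, rfl⟩ := out_exists_conj (Quotient.sound' h)
    ext x
    simp [MulAut.conj_apply, mul_comm])

@[simp] theorem homComp_mk (t : G →* C) (w : MulAut G) :
    homComp t (QuotientGroup.mk w : Out G) = t.comp w.toMonoidHom := rfl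

theorem homComp_one (t : G →* C) : homComp t (1 : Out G) = t := rfl

theorem homComp_mul (t : G →* C) (σ τ : Out G) :
    homComp t (σ * τ) = homComp (homComp t σ) τ := by
  induction σ using QuotientGroup.induction_on
  induction τ using QuotientGroup.induction_on
  rfl

theorem mul_homComp (t t' : G →* C) (σ : Out G) :
    homComp (t * t') σ = homComp t σ * homComp t' σ := by
  induction σ using QuotientGroup.induction_on
  rfl

theorem one_homComp (σ : Out G) : homComp (1 : G →* C) σ = 1 := by
  induction σ using QuotientGroup.induction_on
  rfl

variable (C G)

/-- The group `Ĝ = Hom(G, C) ⋊ Out(G)`, whose elements are the pairs `(t, σ)`. -/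
@[ext] structure GHat : Type u where
  /-- The component in `Hom(G, C)`. -/
  t : G →* C
  /-- The component in `Out(G)`. -/
  σ : Out G

namespace GHat

variable {C G}

/-- The product is `(t₁, σ₁) (t₂, σ₂) = ((t₁ ∘ σ₂) t₂, σ₁ σ₂)`. -/
instance : Mul (GHat C G) := ⟨fun x y => ⟨homComp x.t y.σ * y.t, x.σ * y.σ⟩⟩

instance : One (GHat C G) := ⟨⟨1, 1⟩⟩

instance : Inv (GHat C G) := ⟨fun x => ⟨homComp x.t⁻¹ x.σ⁻¹, x.σ⁻¹⟩⟩

@[simp] theorem mul_t (x y : GHat C G) : (x * y).t = homComp x.t y.σ * y.t := rfl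
@[simp] theorem mul_σ (x y : GHat C G) : (x * y).σ = x.σ * y.σ := rfl
@[simp] theorem one_t : (1 : GHat C G).t = 1 := rfl
@[simp] theorem one_σ : (1 : GHat C G).σ = 1 := rfl
@[simp] theorem inv_t (x : GHat C G) : x⁻¹.t = homComp x.t⁻¹ x.σ⁻¹ := rfl
@[simp] theorem inv_σ (x : GHat C G) : x⁻¹.σ = x.σ⁻¹ := rfl

instance : Group (GHat C G) :=
  Group.ofLeftAxioms
    (fun x y z => GHat.ext (by simp [mul_homComp, homComp_mul, mul_assoc])
      (by simp [mul_assoc]))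
    (fun x => GHat.ext (by simp [one_homComp]) (by simp))
    (fun x => GHat.ext (by
      simp only [mul_t, inv_t, one_t]
      rw [← homComp_mul, inv_mul_cancel, homComp_one, inv_mul_cancel]) (by simp))

end GHat

/-- `Y_G`, the set of injective group homomorphisms `C → Z(G) ∩ Φ(G)`, with `Φ(G)` the
Frattini subgroup. -/
@[ext] structure YSet : Type u where
  /-- The homomorphism, as a map to `G`. -/
  hom : C →* G
  injective : Function.Injective hom
  mem : ∀ c, hom c ∈ Subgroup.center G ⊓ frattini G

namespace YSet

variable {C G}

theorem comm (ζ : YSet C G) (c : C) (g : G) : g * ζ.hom c = ζ.hom c * g :=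
  Subgroup.mem_center_iff.1 (ζ.mem c).1 g

/-- `w ∘ ζ` for an automorphism `w` of `G`. -/
def aut (w : MulAut G) (ζ : YSet C G) : YSet C G where
  hom := w.toMonoidHom.comp ζ.hom
  injective := w.injective.comp ζ.injective
  mem c := by
    have h1 : (Subgroup.center G ⊓ frattini G).comap w.symm.toMonoidHom
        = Subgroup.center G ⊓ frattini G := by
      rw [Subgroup.comap_inf, Subgroup.characteristic_iff_comap_eq.1 inferInstance,
        Subgroup.characteristic_iff_comap_eq.1 inferInstance]
    rw [← h1]
    simpa using ζ.mem c

/-- `ω ∘ ζ` for `ω ∈ Out(G)`; inner automorphisms fix the centre. -/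
def act (ω : Out G) (ζ : YSet C G) : YSet C G :=
  Quotient.liftOn' ω (fun w : MulAut G => ζ.aut w) (by
    intro w w' h
    obtain ⟨g, rfl⟩ := out_exists_conj (Quotient.sound' h)
    ext c
    have := (ζ.aut w).comm c g
    simp only [aut, MonoidHom.comp_apply, MulEquiv.toMonoidHom_eq_coe, MonoidHom.coe_coe,
      MulAut.mul_apply, MulAut.conj_apply] at *
    rw [this, mul_inv_cancel_right])

@[simp] theorem act_mk (w : MulAut G) (ζ : YSet C G) :
    act (QuotientGroup.mk w : Out G) ζ = ζ.aut w := rfl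

theorem act_one (ζ : YSet C G) : act 1 ζ = ζ := rfl

theorem act_mul (σ τ : Out G) (ζ : YSet C G) : act (σ * τ) ζ = act σ (act τ ζ) := by
  induction σ using QuotientGroup.induction_on
  induction τ using QuotientGroup.induction_on
  rfl

end YSet

/-- `𝒴_G = Out(G) × Y_G`. -/
@[ext] structure YY : Type u where
  /-- The component in `Out(G)`. -/
  ω : Out G
  /-- The component in `Y_G`. -/
  ζ : YSet C G

variable {C G}

open Classical in
/-- The product of two elements of `𝒴_G` in `R𝒴_G`: `(ω, ζ) (α, χ)` is `(ωα, ω ∘ χ)` if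
`ζ = ω ∘ χ`, and `0` otherwise. -/
def YY.prod (y z : YY C G) : YY C G →₀ R :=
  if y.ζ = z.ζ.act y.ω then Finsupp.single ⟨y.ω * z.ω, z.ζ.act y.ω⟩ 1 else 0

/-- The bilinear extension of the product of `R𝒴_G`. -/
def yMul : (YY C G →₀ R) →ₗ[R] (YY C G →₀ R) →ₗ[R] (YY C G →₀ R) :=
  Finsupp.linearCombination R fun y => Finsupp.linearCombination R fun z => YY.prod R y z

variable {R}

@[simp] theorem yMul_single (y z : YY C G) (r s : R) :
    yMul R (Finsupp.single y r) (Finsupp.single z s) = (r * s) • YY.prod R y z := by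
  simp [yMul, mul_smul]

theorem YSet.act_inj (σ : Out G) {ζ χ : YSet C G} : ζ.act σ = χ.act σ ↔ ζ = χ := by
  refine ⟨fun h => ?_, fun h => by rw [h]⟩
  rw [← YSet.act_one ζ, ← inv_mul_cancel σ, YSet.act_mul, h, ← YSet.act_mul, inv_mul_cancel,
    YSet.act_one]

theorem prod_assoc (y z w : YY C G) :
    yMul R (YY.prod R y z) (Finsupp.single w 1) = yMul R (Finsupp.single y 1) (YY.prod R z w) := by
  by_cases h1 : y.ζ = z.ζ.act y.ω <;> by_cases h2 : z.ζ = w.ζ.act z.ω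
  · have h3 : z.ζ.act y.ω = w.ζ.act (y.ω * z.ω) := by rw [h2, YSet.act_mul]
    have h4 : y.ζ = (w.ζ.act z.ω).act y.ω := by rw [h1, h2]
    simp only [YY.prod, if_pos h1, if_pos h2, yMul_single, mul_one, one_smul, if_pos h3, if_pos h4,
      mul_assoc, YSet.act_mul]
  · have h3 : ¬ z.ζ.act y.ω = w.ζ.act (y.ω * z.ω) := by rwa [YSet.act_mul, YSet.act_inj]
    simp [YY.prod, if_pos h1, if_neg h2, if_neg h3]
  · have h4 : ¬ y.ζ = (w.ζ.act z.ω).act y.ω := by rwa [← h2]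
    simp [YY.prod, if_neg h1, if_pos h2, if_neg h4]
  · simp [YY.prod, if_neg h1, if_neg h2]

theorem fsingle_eq {ι : Type*} (i : ι) (r : R) :
    Finsupp.single i r = r • Finsupp.single i (1 : R) := by simp

theorem msingle_eq (i : GHat C G) (r : R) :
    MonoidAlgebra.single i r = r • MonoidAlgebra.single i (1 : R) := by simp

/-- An associativity law between bilinear maps may be checked on generators. -/
theorem assoc_of_span {A B D E P Q : Type*} [AddCommGroup A] [AddCommGroup B] [AddCommGroup D]
    [AddCommGroup E] [AddCommGroup P] [AddCommGroup Q] [Module R A] [Module R B] [Module R D]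
    [Module R E] [Module R P] [Module R Q] {sA : Set A} {sB : Set B} {sD : Set D}
    (hA : Submodule.span R sA = ⊤) (hB : Submodule.span R sB = ⊤) (hD : Submodule.span R sD = ⊤)
    (f : A →ₗ[R] B →ₗ[R] P) (g : P →ₗ[R] D →ₗ[R] E) (f' : A →ₗ[R] Q →ₗ[R] E)
    (g' : B →ₗ[R] D →ₗ[R] Q)
    (h : ∀ a ∈ sA, ∀ b ∈ sB, ∀ d ∈ sD, g (f a b) d = f' a (g' b d)) (a : A) (b : B) (d : D) :
    g (f a b) d = f' a (g' b d) := by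
  have : f.compr₂ g = (LinearMap.lcomp R (D →ₗ[R] E) g') ∘ₗ (LinearMap.llcomp R D Q E) ∘ₗ f' :=
    LinearMap.ext_on hA fun a ha => LinearMap.ext_on hB fun b hb =>
      LinearMap.ext_on hD fun d hd => h a ha b hb d hd
  exact LinearMap.congr_fun (LinearMap.congr_fun (LinearMap.congr_fun this a) b) d

theorem span_y : Submodule.span R (Set.range fun y : YY C G => Finsupp.single y (1 : R)) = ⊤ := by
  rw [eq_top_iff]
  rintro f -
  induction f using Finsupp.induction_linear with
  | zero => exact zero_mem _
  | add f g hf hg => exact add_mem hf hg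
  | single y r => rw [fsingle_eq]; exact Submodule.smul_mem _ _ (Submodule.subset_span ⟨y, rfl⟩)

theorem span_g : Submodule.span R
    (Set.range fun x : GHat C G => MonoidAlgebra.single x (1 : R)) = ⊤ := by
  rw [eq_top_iff]
  rintro f -
  induction f using MonoidAlgebra.induction_linear with
  | zero => exact zero_mem _
  | add f g hf hg => exact add_mem hf hg
  | single y r => rw [msingle_eq]; exact Submodule.smul_mem _ _ (Submodule.subset_span ⟨y, rfl⟩)

variable (R)

variable (C G)

/-- The `R`-algebra `R𝒴_G ⊕ R Ĝ`: the direct sum of the algebra `R𝒴_G` (without unit) and the group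
algebra `R Ĝ`, with `R Ĝ` acting on `R𝒴_G` on both sides. -/
@[ext] structure HAlg : Type (max u v) where
  /-- The component in `R𝒴_G`. -/
  y : YY C G →₀ R
  /-- The component in the group algebra. -/
  g : MonoidAlgebra R (GHat C G)

namespace HAlg

variable {R C G}

/-- The underlying direct sum. -/
def equivProd : HAlg R C G ≃ (YY C G →₀ R) × MonoidAlgebra R (GHat C G) :=
  ⟨fun a => (a.y, a.g), fun a => ⟨a.1, a.2⟩, fun _ => rfl, fun _ => rfl⟩

instance : AddCommGroup (HAlg R C G) := equivProd.addCommGroup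

instance : Module R (HAlg R C G) := equivProd.module R

instance : One (HAlg R C G) := ⟨⟨0, 1⟩⟩

@[simp] theorem one_y : (1 : HAlg R C G).y = 0 := rfl
@[simp] theorem one_g : (1 : HAlg R C G).g = 1 := rfl
@[simp] theorem add_y (a b : HAlg R C G) : (a + b).y = a.y + b.y := rfl
@[simp] theorem add_g (a b : HAlg R C G) : (a + b).g = a.g + b.g := rfl
@[simp] theorem zero_y : (0 : HAlg R C G).y = 0 := rfl
@[simp] theorem zero_g : (0 : HAlg R C G).g = 0 := rfl
@[simp] theorem smul_y (r : R) (a : HAlg R C G) : (r • a).y = r • a.y := rfl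
@[simp] theorem smul_g (r : R) (a : HAlg R C G) : (r • a).g = r • a.g := rfl

theorem assoc_yyy (x y z : YY C G →₀ R) :
    yMul R (yMul R x y) z = yMul R x (yMul R y z) :=
  assoc_of_span span_y span_y span_y (yMul R) (yMul R) (yMul R) (yMul R) (by
    rintro _ ⟨x, rfl⟩ _ ⟨y, rfl⟩ _ ⟨z, rfl⟩
    simpa only [yMul_single, mul_one, one_smul] using prod_assoc x y z) x y z

end HAlg

variable {C G}

variable [hC : Fact (Nat.card C).Prime]

/-- When `C` has prime order, every homomorphism `G → C` is trivial on the Frattini subgroup. -/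
theorem hom_frattini (t : G →* C) {x : G} (hx : x ∈ frattini G) : t x = 1 := by
  by_contra h
  have hr : t.range = ⊤ :=
    (t.range.eq_bot_or_eq_top_of_prime_card).resolve_left fun hb => h (by
      have : t x ∈ t.range := ⟨x, rfl⟩
      rwa [hb, Subgroup.mem_bot] at this)
  have hi : t.ker.index = Nat.card C := by
    rw [Subgroup.index_ker, hr, Nat.card_congr Subgroup.topEquiv.toEquiv]
  have hco : IsCoatom t.ker := by
    refine ⟨fun ht => ?_, fun M hM => ?_⟩
    · rw [ht, Subgroup.index_top] at hi
      exact hC.out.ne_one hi.symm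
    · have hd : M.index ∣ Nat.card C := hi ▸ Subgroup.index_dvd_of_le hM.le
      rcases (Nat.dvd_prime hC.out).1 hd with h1 | h1
      · exact Subgroup.index_eq_one.1 h1
      · exfalso
        have h2 := Subgroup.relIndex_mul_index hM.le
        rw [h1, hi] at h2
        have h3 : t.ker.relIndex M = 1 :=
          Nat.eq_of_mul_eq_mul_right hC.out.pos (by rw [h2, one_mul])
        exact hM.not_ge (Subgroup.relIndex_eq_one.1 h3)
  exact h (frattini_le_coatom hco hx)

/-- `t ∘ ζ = 1` for all `t ∈ Hom(G, C)` and `ζ ∈ Y_G`. Hence `c ↦ t(ζ(c)) c` is always the identity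
automorphism of `C`. -/
@[simp] theorem YSet.hom_comp (t : G →* C) (ζ : YSet C G) (c : C) : t (ζ.hom c) = 1 :=
  hom_frattini t (ζ.mem c).2

/-- The automorphism `g ↦ w(g) ζ(f(g))` of `G`, for `w ∈ Aut(G)`, `ζ ∈ Y_G` and `f ∈ Hom(G, C)`. -/
def twistAut (w : MulAut G) (ζ : YSet C G) (f : G →* C) : MulAut G where
  toFun g := w g * ζ.hom (f g)
  invFun h := w.symm (h * ζ.hom (f (w.symm h))⁻¹)
  left_inv g := by
    have h : ∀ c, f (w.symm (ζ.hom c)) = 1 := fun c => (ζ.aut w.symm).hom_comp f c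
    simp only [map_mul, map_inv, MulEquiv.symm_apply_apply, h, mul_one, mul_inv_cancel_right]
  right_inv g := by
    have h : ∀ c, f (w.symm (ζ.hom c)) = 1 := fun c => (ζ.aut w.symm).hom_comp f c
    have h' : f (w.symm (g * ζ.hom (f (w.symm g))⁻¹)) = f (w.symm g) := by
      rw [map_mul, map_mul, h, mul_one]
    beta_reduce
    rw [h', MulEquiv.apply_symm_apply, mul_assoc, ← map_mul, inv_mul_cancel, map_one, mul_one]
  map_mul' g h := by
    simp only [map_mul]
    have := ζ.comm (f g) (w h)
    calc w g * w h * (ζ.hom (f g) * ζ.hom (f h))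
        = w g * (w h * ζ.hom (f g)) * ζ.hom (f h) := by simp only [mul_assoc]
      _ = w g * ζ.hom (f g) * (w h * ζ.hom (f h)) := by rw [this]; simp only [mul_assoc]

@[simp] theorem twistAut_apply (w : MulAut G) (ζ : YSet C G) (f : G →* C) (g : G) :
    twistAut w ζ f g = w g * ζ.hom (f g) := rfl

/-- The class in `Out(G)` of `g ↦ ω(g) ζ(f(g))`, for `ω ∈ Out(G)`. -/
def twist (ω : Out G) (ζ : YSet C G) (f : G →* C) : Out G :=
  Quotient.liftOn' ω (fun w : MulAut G => (QuotientGroup.mk (twistAut w ζ f) : Out G)) (by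
    intro w w' h
    obtain ⟨g, rfl⟩ := out_exists_conj (Quotient.sound' h)
    rw [← out_mk_conj_mul g (twistAut w ζ f)]
    congr 1
    ext x
    have := ζ.comm (f x) g⁻¹
    simp only [MulAut.mul_apply, MulAut.conj_apply, twistAut_apply, mul_assoc, this])

@[simp] theorem twist_mk (w : MulAut G) (ζ : YSet C G) (f : G →* C) :
    twist (QuotientGroup.mk w : Out G) ζ f = QuotientGroup.mk (twistAut w ζ f) := rfl

theorem mul_twist (σ ω : Out G) (ζ : YSet C G) (f : G →* C) :
    σ * twist ω ζ f = twist (σ * ω) (ζ.act σ) f := by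
  induction σ using QuotientGroup.induction_on
  induction ω using QuotientGroup.induction_on
  rename_i s w
  rw [twist_mk, YSet.act_mk, ← QuotientGroup.mk_mul, ← QuotientGroup.mk_mul, twist_mk]
  congr 1
  ext x
  simp [YSet.aut]

theorem twist_mul (ω σ : Out G) (ζ : YSet C G) (f : G →* C) :
    twist ω ζ f * σ = twist (ω * σ) ζ (homComp f σ) := by
  induction σ using QuotientGroup.induction_on
  induction ω using QuotientGroup.induction_on
  rw [twist_mk, ← QuotientGroup.mk_mul, ← QuotientGroup.mk_mul, twist_mk]
  congr 1
  ext x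
  simp

theorem twist_twist (ω : Out G) (ζ : YSet C G) (f f' : G →* C) :
    twist (twist ω ζ f) ζ f' = twist ω ζ (f * f') := by
  induction ω using QuotientGroup.induction_on
  rw [twist_mk, twist_mk, twist_mk]
  congr 1
  ext x
  simp [mul_assoc]

theorem twist_one (ω : Out G) (ζ : YSet C G) : twist ω ζ 1 = ω := by
  induction ω using QuotientGroup.induction_on
  rw [twist_mk]
  congr 1
  ext x
  simp

theorem twist_act (ω : Out G) (ζ χ : YSet C G) (f : G →* C) :
    χ.act (twist ω ζ f) = χ.act ω := by
  induction ω using QuotientGroup.induction_on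
  ext x
  simp [YSet.aut]

theorem homComp_twist (t : G →* C) (ω : Out G) (ζ : YSet C G) (f : G →* C) :
    homComp t (twist ω ζ f) = homComp t ω := by
  induction ω using QuotientGroup.induction_on
  ext x
  simp

/-- The left action of `Ĝ` on `𝒴_G`: `(t, σ) (ω, ζ) = (σ s, σ ∘ ζ)`, where `s` is the class of the
automorphism `g ↦ ω(g) ζ(t(ω(g)))`. -/
def YY.left (x : GHat C G) (y : YY C G) : YY C G :=
  ⟨x.σ * twist y.ω y.ζ (homComp x.t y.ω), y.ζ.act x.σ⟩

/-- The right action of `Ĝ` on `𝒴_G`: `(ω, ζ) (t, σ) = (u, ζ)`, where `u` is the class of the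
automorphism `g ↦ ω(σ(g)) ζ(t(g))`. -/
def YY.right (y : YY C G) (x : GHat C G) : YY C G :=
  ⟨twist (y.ω * x.σ) y.ζ x.t, y.ζ⟩

/-- The left action of `R Ĝ` on `R𝒴_G`. -/
def yLeft : MonoidAlgebra R (GHat C G) →ₗ[R] (YY C G →₀ R) →ₗ[R] (YY C G →₀ R) :=
  (Finsupp.linearCombination R fun x : GHat C G =>
    Finsupp.linearCombination R fun y : YY C G => Finsupp.single (YY.left x y) (1 : R)) ∘ₗ
    (MonoidAlgebra.coeffLinearEquiv R).toLinearMap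

/-- The right action of `R Ĝ` on `R𝒴_G`. -/
def yRight : (YY C G →₀ R) →ₗ[R] MonoidAlgebra R (GHat C G) →ₗ[R] (YY C G →₀ R) :=
  Finsupp.linearCombination R fun y : YY C G =>
    (Finsupp.linearCombination R fun x : GHat C G => Finsupp.single (YY.right y x) (1 : R)) ∘ₗ
    (MonoidAlgebra.coeffLinearEquiv R).toLinearMap

section Lemmas

variable {R}

@[simp] theorem yLeft_single (x : GHat C G) (y : YY C G) (r s : R) :
    yLeft R (MonoidAlgebra.single x r) (Finsupp.single y s) =
      Finsupp.single (YY.left x y) (r * s) := by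
  simp [yLeft]

@[simp] theorem yRight_single (x : GHat C G) (y : YY C G) (r s : R) :
    yRight R (Finsupp.single y r) (MonoidAlgebra.single x s) =
      Finsupp.single (YY.right y x) (r * s) := by
  simp [yRight]

theorem YY.mul_left (x x' : GHat C G) (y : YY C G) :
    YY.left (x * x') y = YY.left x (YY.left x' y) := by
  ext1
  · simp only [YY.left, GHat.mul_t, GHat.mul_σ, mul_homComp, homComp_mul, homComp_twist,
      mul_twist, YSet.act_mul, twist_twist, mul_assoc]
    rw [mul_comm]
  · simp [YY.left, YSet.act_mul]

theorem YY.right_mul (x x' : GHat C G) (y : YY C G) :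
    YY.right y (x * x') = YY.right (YY.right y x) x' := by
  ext1
  · simp only [YY.right, GHat.mul_t, GHat.mul_σ, twist_mul, twist_twist, mul_assoc]
  · rfl

theorem YY.left_right (x x' : GHat C G) (y : YY C G) :
    YY.right (YY.left x y) x' = YY.left x (YY.right y x') := by
  ext1
  · simp only [YY.right, YY.left, mul_twist, twist_mul, twist_twist, homComp_twist, homComp_mul,
      mul_assoc]
    rw [mul_comm]
  · rfl

theorem YY.one_left (y : YY C G) : YY.left 1 y = y := by
  ext1
  · simp [YY.left, one_homComp, twist_one]
  · simp [YY.left, YSet.act_one]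

theorem YY.right_one (y : YY C G) : YY.right y 1 = y := by
  ext1
  · simp [YY.right, twist_one]
  · rfl

theorem yLeft_prod (x : GHat C G) (y z : YY C G) :
    yLeft R (MonoidAlgebra.single x 1) (YY.prod R y z) = YY.prod R (YY.left x y) z := by
  have h : (YY.left x y).ζ = z.ζ.act (YY.left x y).ω ↔ y.ζ = z.ζ.act y.ω := by
    simp only [YY.left, YSet.act_mul, twist_act, YSet.act_inj]
  by_cases hy : y.ζ = z.ζ.act y.ω
  · rw [YY.prod, YY.prod, if_pos hy, if_pos (h.2 hy), yLeft_single, mul_one]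
    congr 1
    ext1
    · simp only [YY.left, mul_twist, twist_mul, homComp_mul, ← hy, mul_assoc]
    · simp only [YY.left, YSet.act_mul, twist_act]
  · rw [YY.prod, YY.prod, if_neg hy, if_neg (mt h.1 hy), map_zero]

theorem prod_yRight (x : GHat C G) (y z : YY C G) :
    yRight R (YY.prod R y z) (MonoidAlgebra.single x 1) = YY.prod R y (YY.right z x) := by
  have h : y.ζ = (YY.right z x).ζ.act y.ω ↔ y.ζ = z.ζ.act y.ω := Iff.rfl
  by_cases hy : y.ζ = z.ζ.act y.ω
  · rw [YY.prod, YY.prod, if_pos hy, if_pos (h.2 hy), yRight_single, mul_one]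
    congr 1
    ext1
    · simp only [YY.right, mul_twist, mul_assoc]
    · rfl
  · rw [YY.prod, YY.prod, if_neg hy, if_neg (mt h.1 hy), map_zero, LinearMap.zero_apply]

theorem prod_middle (x : GHat C G) (y z : YY C G) :
    YY.prod R (YY.right y x) z = YY.prod R y (YY.left x z) := by
  have h : (YY.right y x).ζ = z.ζ.act (YY.right y x).ω ↔ y.ζ = (YY.left x z).ζ.act y.ω := by
    simp only [YY.left, YY.right, YSet.act_mul, twist_act]
  by_cases hy : y.ζ = (YY.left x z).ζ.act y.ω
  · rw [YY.prod, YY.prod, if_pos hy, if_pos (h.2 hy)]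
    congr 1
    ext1
    · simp only [YY.left, YY.right, mul_twist, twist_mul, mul_assoc] at *
      rw [hy]
    · simp only [YY.left, YY.right, YSet.act_mul, twist_act]
  · rw [YY.prod, YY.prod, if_neg hy, if_neg (mt h.1 hy)]

end Lemmas

namespace HAlg

variable {R}

/-- `(y + a) (y' + a') = (y y' + a y' + y a') + a a'`. -/
instance : Mul (HAlg R C G) :=
  ⟨fun a b => ⟨yMul R a.y b.y + yLeft R a.g b.y + yRight R a.y b.g, a.g * b.g⟩⟩

theorem mul_y (a b : HAlg R C G) :
    (a * b).y = yMul R a.y b.y + yLeft R a.g b.y + yRight R a.y b.g := rfl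
theorem mul_g (a b : HAlg R C G) : (a * b).g = a.g * b.g := rfl
theorem yLeft_one (y : YY C G →₀ R) : yLeft R 1 y = y := by
  induction y using Finsupp.induction_linear with
  | zero => simp
  | add f g hf hg => rw [map_add, hf, hg]
  | single y r => rw [MonoidAlgebra.one_def, yLeft_single, YY.one_left, one_mul]

theorem yRight_one (y : YY C G →₀ R) : yRight R y 1 = y := by
  induction y using Finsupp.induction_linear with
  | zero => simp
  | add f g hf hg => rw [map_add, LinearMap.add_apply, hf, hg]
  | single y r => rw [MonoidAlgebra.one_def, yRight_single, YY.right_one, mul_one]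

theorem assoc_gyy (a : MonoidAlgebra R (GHat C G)) (y z : YY C G →₀ R) :
    yMul R (yLeft R a y) z = yLeft R a (yMul R y z) :=
  assoc_of_span span_g span_y span_y (yLeft R) (yMul R) (yLeft R) (yMul R) (by
    rintro _ ⟨x, rfl⟩ _ ⟨y, rfl⟩ _ ⟨z, rfl⟩
    simpa only [yMul_single, yLeft_single, mul_one, one_smul] using (yLeft_prod x y z).symm) a y z

theorem assoc_ygy (y : YY C G →₀ R) (a : MonoidAlgebra R (GHat C G)) (z : YY C G →₀ R) :
    yMul R (yRight R y a) z = yMul R y (yLeft R a z) :=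
  assoc_of_span span_y span_g span_y (yRight R) (yMul R) (yMul R) (yLeft R) (by
    rintro _ ⟨y, rfl⟩ _ ⟨x, rfl⟩ _ ⟨z, rfl⟩
    simpa only [yMul_single, yLeft_single, yRight_single, mul_one, one_smul] using
      prod_middle x y z) y a z

theorem assoc_yyg (y z : YY C G →₀ R) (a : MonoidAlgebra R (GHat C G)) :
    yRight R (yMul R y z) a = yMul R y (yRight R z a) :=
  assoc_of_span span_y span_y span_g (yMul R) (yRight R) (yMul R) (yRight R) (by
    rintro _ ⟨y, rfl⟩ _ ⟨z, rfl⟩ _ ⟨x, rfl⟩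
    simpa only [yMul_single, yRight_single, mul_one, one_smul] using prod_yRight x y z) y z a

theorem assoc_ggy (a b : MonoidAlgebra R (GHat C G)) (y : YY C G →₀ R) :
    yLeft R (a * b) y = yLeft R a (yLeft R b y) :=
  assoc_of_span span_g span_g span_y (LinearMap.mul R _) (yLeft R) (yLeft R) (yLeft R) (by
    rintro _ ⟨a, rfl⟩ _ ⟨b, rfl⟩ _ ⟨y, rfl⟩
    simp only [LinearMap.mul_apply', MonoidAlgebra.single_mul_single, yLeft_single, mul_one,
      YY.mul_left]) a b y

theorem assoc_ygg (y : YY C G →₀ R) (a b : MonoidAlgebra R (GHat C G)) :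
    yRight R (yRight R y a) b = yRight R y (a * b) :=
  assoc_of_span span_y span_g span_g (yRight R) (yRight R) (yRight R) (LinearMap.mul R _) (by
    rintro _ ⟨y, rfl⟩ _ ⟨a, rfl⟩ _ ⟨b, rfl⟩
    simp only [LinearMap.mul_apply', MonoidAlgebra.single_mul_single, yRight_single, mul_one,
      YY.right_mul]) y a b

theorem assoc_gyg (a : MonoidAlgebra R (GHat C G)) (y : YY C G →₀ R)
    (b : MonoidAlgebra R (GHat C G)) :
    yRight R (yLeft R a y) b = yLeft R a (yRight R y b) :=
  assoc_of_span span_g span_y span_g (yLeft R) (yRight R) (yLeft R) (yRight R) (by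
    rintro _ ⟨a, rfl⟩ _ ⟨y, rfl⟩ _ ⟨b, rfl⟩
    simp only [yLeft_single, yRight_single, mul_one, YY.left_right]) a y b

instance : Ring (HAlg R C G) :=
  { (inferInstance : AddCommGroup (HAlg R C G)),
    (inferInstance : Mul (HAlg R C G)),
    (inferInstance : One (HAlg R C G)) with
    left_distrib := fun a b c => HAlg.ext
      (by simp only [mul_y, add_y, add_g, map_add]; abel) (mul_add _ _ _)
    right_distrib := fun a b c => HAlg.ext
      (by simp only [mul_y, add_y, add_g, map_add, LinearMap.add_apply]; abel) (add_mul _ _ _)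
    zero_mul := fun a => HAlg.ext (by simp [mul_y]) (zero_mul _)
    mul_zero := fun a => HAlg.ext (by simp [mul_y]) (mul_zero _)
    mul_assoc := fun a b c => HAlg.ext
      (by
        simp only [mul_y, mul_g, map_add, LinearMap.add_apply, assoc_yyy, assoc_gyy, assoc_ygy,
          assoc_yyg, assoc_ggy, assoc_ygg, assoc_gyg]
        abel) (mul_assoc _ _ _)
    one_mul := fun a => HAlg.ext (by simp [mul_y, yLeft_one]) (one_mul _)
    mul_one := fun a => HAlg.ext (by simp [mul_y, yRight_one]) (mul_one _) }

instance : Algebra R (HAlg R C G) :=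
  Algebra.ofModule
    (fun r a b => HAlg.ext
      (by simp only [mul_y, smul_y, smul_g, map_smul, LinearMap.smul_apply, smul_add])
      (smul_mul_assoc _ _ _))
    (fun r a b => HAlg.ext
      (by simp only [mul_y, smul_y, smul_g, map_smul, smul_add]) (mul_smul_comm _ _ _))

end HAlg

end Model

end FibredBiset

end

noncomputable section

namespace FibredBiset

/-! ### Transitive sets and the counting of orbits by type -/

namespace GSet

variable {Γ : Type u} [Group Γ]

/-! The algebra `RB_C^1(G × G)` is spanned by the classes of transitive sets `((G × G) × C) / S`
with `S` meeting `C` trivially, and such a class depends only on the conjugacy class of `S`.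
Everything is therefore a computation with subgroups `S`. The stabilizer of a point of `T ∘ Y` is
the relational composite `star U V` of the stabilizers of a point of `T` and a point of `Y`, and if
`U` projects onto the middle group, then the composite of the transitive sets of `U` and `V` is the
free part of the transitive set of `star U V`.

Call `S` essential if its first projection is onto `G`, if `(g, 1, 1) ∈ S` forces `g = 1`, and if
`(g, 1, c) ∈ S` forces `g ∈ Φ(G)`. When one of the conditions fails, `S` is a composite through a
proper subgroup or a proper quotient of `G`, so its class lies in `I(G)`
(`freeCls_mem_of_not_essential`). Conversely an essential subgroup is never a composite through a
group of smaller order (`Essential.card_le`), so the form counting the orbits of type `S` vanishes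
on `I(G)` (`orbitCount_eq_zero_of_mem`). Hence the classes of essential fibred subgroups, up to
conjugacy, form an `R`-basis of the quotient.

By a count of orders, these subgroups are exactly the graphs `{(w(h), h, t(h))}` and the twisted
subgroups `{(w(h) ζ(c)⁻¹, h, c)}` (`Essential.eq_graph_or_twist`). The primality of `|C|` enters
here: a homomorphism `G → C` kills `Φ(G)`, and a homomorphism to `C` is trivial or onto on any given
subgroup. Up to conjugacy the two families are indexed by `Ĝ` and `𝒴_G`. Their `star` products
reproduce the multiplication of `R𝒴_G ⊕ RĜ`; two twisted subgroups whose parameters do not match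
have a composite that is not essential, hence product zero. If `p` does not divide `|Z(G)|`, no
injection `C → Z(G)` exists, `𝒴_G` is empty and only `RĜ` remains. -/

theorem coset_iso_of_transitive [Finite Γ] {X : GSet Γ} {S : Subgroup Γ} (x : X)
    (hx : ∀ y : X, ∃ a : Γ, a • x = y) (hS : ∀ a : Γ, a ∈ S ↔ a • x = x) :
    (coset S).Iso X := by
  refine Iso.of_rel (fun (q : Γ ⧸ S) (y : X) => ∃ a : Γ, q = QuotientGroup.mk a ∧ y = a • x)
    ?_ ?_ ?_ ?_
  · intro q
    obtain ⟨a, rfl⟩ := QuotientGroup.mk_surjective q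
    exact ⟨_, a, rfl, rfl⟩
  · intro y
    obtain ⟨a, rfl⟩ := hx y
    exact ⟨_, a, rfl, rfl⟩
  · rintro _ _ _ _ ⟨a, rfl, rfl⟩ ⟨b, rfl, rfl⟩
    rw [QuotientGroup.eq, hS, mul_smul, inv_smul_eq_iff, eq_comm]
  · rintro b _ _ ⟨a, rfl, rfl⟩
    exact ⟨b * a, rfl, (mul_smul _ _ _).symm⟩

theorem smul_mk_coset_eq [Finite Γ] (S : Subgroup Γ) (a g : Γ) :
    (a • (QuotientGroup.mk g : Γ ⧸ S) = QuotientGroup.mk g) ↔ g⁻¹ * a * g ∈ S := by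
  rw [MulAction.Quotient.smul_mk, eq_comm, QuotientGroup.eq, smul_eq_mul, mul_assoc]

theorem coset_iso_of_conj [Finite Γ] {S S' : Subgroup Γ} (g : Γ)
    (h : ∀ a, a ∈ S' ↔ g⁻¹ * a * g ∈ S) : (coset S').Iso (coset S) := by
  refine coset_iso_of_transitive (X := coset S) (QuotientGroup.mk g) (fun y => ?_) fun a => ?_
  · obtain ⟨b, rfl⟩ := QuotientGroup.mk_surjective y
    exact ⟨b * g⁻¹, by rw [MulAction.Quotient.smul_mk, smul_eq_mul, inv_mul_cancel_right]⟩
  · rw [h, smul_mk_coset_eq]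

instance orbitComplAction (X : GSet Γ) (x : X) :
    MulAction Γ {y : X // y ∉ MulAction.orbit Γ x} where
  smul a y := ⟨a • y.1, fun ⟨b, hb⟩ => y.2 ⟨a⁻¹ * b, by
    beta_reduce
    rw [mul_smul, inv_smul_eq_iff]
    exact hb⟩⟩
  one_smul y := Subtype.ext (one_smul _ _)
  mul_smul a b y := Subtype.ext (mul_smul _ _ _)

/-- The complement of an orbit in a finite `Γ`-set. -/
abbrev orbitCompl (X : GSet Γ) (x : X) : GSet Γ := ⟨{y : X // y ∉ MulAction.orbit Γ x}⟩

theorem iso_disjUnion_orbit [Finite Γ] (X : GSet Γ) (x : X) :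
    X.Iso ((coset (MulAction.stabilizer Γ x)).disjUnion (orbitCompl X x)) := by
  refine Iso.symm (Iso.of_rel (fun (q : (Γ ⧸ MulAction.stabilizer Γ x) ⊕
      {y : X // y ∉ MulAction.orbit Γ x}) (y : X) =>
    (∃ a : Γ, q = Sum.inl (QuotientGroup.mk a) ∧ y = a • x) ∨
      ∃ w, q = Sum.inr w ∧ y = w.1) ?_ ?_ ?_ ?_)
  · rintro (q | w)
    · obtain ⟨a, rfl⟩ := QuotientGroup.mk_surjective q
      exact ⟨_, Or.inl ⟨a, rfl, rfl⟩⟩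
    · exact ⟨_, Or.inr ⟨w, rfl, rfl⟩⟩
  · intro y
    by_cases hy : y ∈ MulAction.orbit Γ x
    · obtain ⟨a, rfl⟩ := hy
      exact ⟨_, Or.inl ⟨a, rfl, rfl⟩⟩
    · exact ⟨_, Or.inr ⟨⟨y, hy⟩, rfl, rfl⟩⟩
  · rintro _ _ _ _ (⟨a, rfl, rfl⟩ | ⟨w, rfl, rfl⟩) (⟨b, rfl, rfl⟩ | ⟨w', rfl, rfl⟩)
    · rw [Sum.inl.injEq, QuotientGroup.eq, MulAction.mem_stabilizer_iff, mul_smul,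
        inv_smul_eq_iff, eq_comm]
    · simp only [reduceCtorEq, false_iff]
      exact fun h => w'.2 ⟨a, h⟩
    · simp only [reduceCtorEq, false_iff]
      exact fun h => w.2 ⟨b, h.symm⟩
    · rw [Sum.inr.injEq, Subtype.ext_iff]
  · rintro b _ _ (⟨a, rfl, rfl⟩ | ⟨w, rfl, rfl⟩)
    · exact Or.inl ⟨b * a, rfl, (mul_smul _ _ _).symm⟩
    · exact Or.inr ⟨b • w, rfl, rfl⟩

/-- The orbits of `X` that contain a point with stabilizer `S`. -/
def orbitsOfType (S : Subgroup Γ) (X : GSet Γ) : Set (Set X) :=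
  MulAction.orbit Γ '' {x : X | MulAction.stabilizer Γ x = S}

theorem orbit_image {X Y : GSet Γ} (f : X → Y) (hf : ∀ (a : Γ) x, f (a • x) = a • f x) (x : X) :
    MulAction.orbit Γ (f x) = f '' MulAction.orbit Γ x := by
  ext y
  simp only [MulAction.mem_orbit_iff, Set.mem_image, exists_exists_eq_and, hf]

theorem stabilizer_image {X Y : GSet Γ} {f : X → Y} (hi : Function.Injective f)
    (hf : ∀ (a : Γ) x, f (a • x) = a • f x) (x : X) :
    MulAction.stabilizer Γ (f x) = MulAction.stabilizer Γ x := by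
  ext a
  simp only [MulAction.mem_stabilizer_iff, ← hf, hi.eq_iff]

theorem image_orbitsOfType {X Y : GSet Γ} {f : X → Y}
    (hf : ∀ (a : Γ) x, f (a • x) = a • f x) (S : Subgroup Γ) :
    Set.image f '' orbitsOfType S X =
      MulAction.orbit Γ '' (f '' {x : X | MulAction.stabilizer Γ x = S}) := by
  rw [orbitsOfType, Set.image_image, Set.image_image]
  simp only [orbit_image f hf]

theorem ncard_orbitsOfType_iso (S : Subgroup Γ) {X Y : GSet Γ} (h : X.Iso Y) :
    (orbitsOfType S X).ncard = (orbitsOfType S Y).ncard := by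
  obtain ⟨e, he⟩ := h
  rw [← Set.ncard_image_of_injective _ (Set.image_injective.2 e.injective),
    image_orbitsOfType he]
  congr 2
  ext y
  constructor
  · rintro ⟨x, hx, rfl⟩
    rwa [Set.mem_ofPred_eq, stabilizer_image e.injective he]
  · intro hy
    refine ⟨e.symm y, ?_, e.apply_symm_apply y⟩
    rwa [Set.mem_ofPred_eq, ← stabilizer_image e.injective he, e.apply_symm_apply]

/-- Additivity makes the count a linear form. Counting orbits rather than points with stabilizer `S`
gives the value 1 on `Γ / S` itself, so nothing has to be invertible in `R`. -/
theorem ncard_orbitsOfType_disjUnion (S : Subgroup Γ) (X Y : GSet Γ) :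
    (orbitsOfType S (X.disjUnion Y)).ncard =
      (orbitsOfType S X).ncard + (orbitsOfType S Y).ncard := by
  have hl : ∀ (a : Γ) (x : X), (Sum.inl (a • x) : X.disjUnion Y) = a • (Sum.inl x : X ⊕ Y) :=
    fun _ _ => rfl
  have hr : ∀ (a : Γ) (y : Y), (Sum.inr (a • y) : X.disjUnion Y) = a • (Sum.inr y : X ⊕ Y) :=
    fun _ _ => rfl
  have il : Function.Injective (Sum.inl : X → X.disjUnion Y) := Sum.inl_injective
  have ir : Function.Injective (Sum.inr : Y → X.disjUnion Y) := Sum.inr_injective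
  have sl (x : X) := stabilizer_image (Y := X.disjUnion Y) il hl x
  have sr (y : Y) := stabilizer_image (Y := X.disjUnion Y) ir hr y
  rw [← Set.ncard_image_of_injective (orbitsOfType S X) (Set.image_injective.2 il),
    ← Set.ncard_image_of_injective (orbitsOfType S Y) (Set.image_injective.2 ir),
    image_orbitsOfType (Y := X.disjUnion Y) hl, image_orbitsOfType (Y := X.disjUnion Y) hr, ← Set.ncard_union_eq]
  · rw [← Set.image_union, orbitsOfType]
    congr 2
    ext w
    constructor
    · rcases w with x | y <;> intro h <;> rw [Set.mem_ofPred_eq] at h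
      · exact Or.inl ⟨x, (sl x).symm.trans h, rfl⟩
      · exact Or.inr ⟨y, (sr y).symm.trans h, rfl⟩
    · rintro (⟨x, h, rfl⟩ | ⟨y, h, rfl⟩) <;> rw [Set.mem_ofPred_eq] at h ⊢
      · exact (sl x).trans h
      · exact (sr y).trans h
  · rw [Set.disjoint_left]
    rintro _ ⟨_, ⟨x, -, rfl⟩, rfl⟩ ⟨_, ⟨y, -, rfl⟩, h⟩
    have h1 : (Sum.inl x : X ⊕ Y) ∈ MulAction.orbit Γ (Sum.inr y : X.disjUnion Y) :=
      h ▸ MulAction.mem_orbit_self (M := Γ) (Sum.inl x : X.disjUnion Y)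
    obtain ⟨a, ha⟩ := h1
    exact Sum.inr_ne_inl ha

theorem ncard_orbitsOfType_coset_self [Finite Γ] (S : Subgroup Γ) :
    (orbitsOfType S (coset S)).ncard = 1 := by
  rw [Set.ncard_eq_one]
  refine ⟨Set.univ, ?_⟩
  ext O
  simp only [orbitsOfType, Set.mem_image, Set.mem_singleton_iff]
  constructor
  · rintro ⟨x, -, rfl⟩
    exact MulAction.orbit_eq_univ Γ x
  · rintro rfl
    refine ⟨QuotientGroup.mk 1, ?_, MulAction.orbit_eq_univ Γ _⟩
    ext a
    rw [MulAction.mem_stabilizer_iff, smul_mk_coset_eq]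
    simp

/-- The point stabilizers of `Γ / S'` are exactly the conjugates of `S'`. -/
theorem orbitsOfType_coset_eq_empty [Finite Γ] {S S' : Subgroup Γ}
    (h : ∀ g : Γ, ¬ ∀ a, a ∈ S ↔ g⁻¹ * a * g ∈ S') : orbitsOfType S (coset S') = ∅ := by
  rw [orbitsOfType, Set.image_eq_empty, Set.eq_empty_iff_forall_notMem]
  intro x hx
  obtain ⟨g, rfl⟩ := QuotientGroup.mk_surjective x
  refine h g fun a => ?_
  rw [← smul_mk_coset_eq, ← MulAction.mem_stabilizer_iff]
  exact iff_of_eq (congrArg (a ∈ ·) hx.symm)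

end GSet

/-! ### Counting forms and generators of the Burnside group -/

section

variable (R : Type v) [CommRing R] {Γ : Type u} [Group Γ]

/-- The linear form on the Burnside group counting the orbits that contain a point with
stabilizer `S`. -/
def orbitCount (S : Subgroup Γ) : Burnside R Γ →ₗ[R] R :=
  burnsideLift (fun X => ((GSet.orbitsOfType S X).ncard : R))
    (fun _ _ h => by rw [GSet.ncard_orbitsOfType_iso S h])
    (fun X Y => by rw [GSet.ncard_orbitsOfType_disjUnion, Nat.cast_add])

theorem orbitCount_cls (S : Subgroup Γ) (X : GSet Γ) :
    orbitCount R S (cls R X) = ((GSet.orbitsOfType S X).ncard : R) := by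
  simp [orbitCount]

theorem cls_eq_zero_of_isEmpty (X : GSet Γ) [IsEmpty X] : cls R X = 0 := by
  -- The class of an empty set equals its own double.
  have h : (X.disjUnion X).Iso X :=
    ⟨Equiv.equivOfIsEmpty _ _, fun _ x => isEmptyElim x⟩
  simpa [cls_disjUnion] using cls_iso R h

/-- A submodule containing the classes of the transitive sets `Γ / Γₓ`, `x ∈ X`, contains the
class of `X`. -/
theorem cls_mem_of_stabilizer [Finite Γ] (W : Submodule R (Burnside R Γ)) (X : GSet Γ)
    (h : ∀ x : X, cls R (GSet.coset (MulAction.stabilizer Γ x)) ∈ W) : cls R X ∈ W := by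
  induction hn : Nat.card X using Nat.strong_induction_on generalizing X with
  | _ n ih =>
    rcases isEmpty_or_nonempty X with hX | ⟨⟨x⟩⟩
    · rw [cls_eq_zero_of_isEmpty]; exact zero_mem _
    · rw [cls_iso R (X.iso_disjUnion_orbit x), cls_disjUnion]
      -- Split off the orbit of `x`; the complement is smaller and its points keep their
      -- stabilizers.
      refine add_mem (h x) (ih _ ?_ (X.orbitCompl x) (fun y => ?_) rfl)
      · rw [← hn]
        exact Finite.card_subtype_lt (x := x) (not_not.2 (MulAction.mem_orbit_self x))
      · rw [← GSet.stabilizer_image (X := X.orbitCompl x) (Y := X) Subtype.val_injective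
          (fun _ _ => rfl) y]
        exact h y.1

end

/-! ### Stabilizers in a composition and the Mackey formula -/

section Star

variable {C G H K : Type u} [CommGroup C] [Group G] [Group H] [Group K]

/-- The composition of `U ≤ (G × H) × C` and `V ≤ (H × K) × C` as relations, multiplying the
components in `C`. -/
def star (U : Subgroup ((G × H) × C)) (V : Subgroup ((H × K) × C)) : Subgroup ((G × K) × C) where
  carrier := {a | ∃ h d, ((a.1.1, h), a.2 * d) ∈ U ∧ ((h, a.1.2), d⁻¹) ∈ V}
  one_mem' := ⟨1, 1, by rw [mul_one]; exact U.one_mem, by rw [inv_one]; exact V.one_mem⟩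
  mul_mem' := by
    rintro a b ⟨h, d, h1, h2⟩ ⟨h', d', h1', h2'⟩
    refine ⟨h * h', d * d', ?_, ?_⟩
    · convert U.mul_mem h1 h1' using 1
      simp [mul_mul_mul_comm]
    · convert V.mul_mem h2 h2' using 1
      simp [mul_comm]
  inv_mem' := by
    rintro a ⟨h, d, h1, h2⟩
    refine ⟨h⁻¹, d⁻¹, ?_, ?_⟩
    · convert U.inv_mem h1 using 1
      simp [mul_comm]
    · exact V.inv_mem h2

theorem mem_star {U : Subgroup ((G × H) × C)} {V : Subgroup ((H × K) × C)} {a : (G × K) × C} :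
    a ∈ star U V ↔ ∃ h d, ((a.1.1, h), a.2 * d) ∈ U ∧ ((h, a.1.2), d⁻¹) ∈ V := Iff.rfl

/-- An element fixes the orbit of `(t, y)` exactly when some `(h, d) ∈ H × C` carries the displaced
pair back to `(t, y)`; these `h` and `d` are the bound variables in `star`. -/
theorem stabilizer_orb {T : GSet ((G × H) × C)} {Y : GSet ((H × K) × C)} (t : T) (y : Y) :
    MulAction.stabilizer ((G × K) × C) (orb t y) =
      star (MulAction.stabilizer ((G × H) × C) t) (MulAction.stabilizer ((H × K) × C) y) := by
  ext a
  rw [MulAction.mem_stabilizer_iff, smul_orb, orb_eq_iff, mem_star]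
  simp only [smul_smul, MulAction.mem_stabilizer_iff, Prod.mk_mul_mk, one_mul, mul_one,
    mul_comm a.2]

/-- In general the orbits correspond to the double cosets in `H` of the projections of `U` and `V`.
As `U` projects onto `H` there is only one, so the orbit set is transitive and the stabilizer of its
base point determines it. -/
theorem coset_star_iso [Finite C] [Finite G] [Finite H] [Finite K]
    (U : Subgroup ((G × H) × C)) (V : Subgroup ((H × K) × C))
    (hU : ∀ h, ∃ g c, ((g, h), c) ∈ U) :
    (GSet.coset (star U V)).Iso (orbSet (GSet.coset U) (GSet.coset V)) := by
  refine GSet.coset_iso_of_transitive (X := orbSet (GSet.coset U) (GSet.coset V))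
    (orb (T := GSet.coset U) (Y := GSet.coset V) (QuotientGroup.mk 1) (QuotientGroup.mk 1))
    (fun w => ?_) fun a => ?_
  · obtain ⟨t, y, rfl⟩ := orb_surj w
    obtain ⟨⟨⟨g, h⟩, c⟩, rfl⟩ := QuotientGroup.mk_surjective t
    obtain ⟨⟨⟨h', k⟩, c'⟩, rfl⟩ := QuotientGroup.mk_surjective y
    -- An element of `U` with this middle coordinate moves the base point into alignment with the
    -- given pair.
    obtain ⟨g₀, c₀, h₀⟩ := hU (h'⁻¹ * h)
    refine ⟨((g * g₀⁻¹, k), c' * c * c₀⁻¹), ?_⟩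
    rw [smul_orb, orb_eq_iff]
    refine ⟨h', c'⁻¹, ?_, ?_⟩
    · rw [smul_smul, MulAction.Quotient.smul_mk, QuotientGroup.eq]
      convert h₀ using 1
      simp
      rw [mul_assoc c₀, inv_mul_cancel_right, mul_comm c₀, inv_mul_cancel_comm]
    · rw [smul_smul, MulAction.Quotient.smul_mk, QuotientGroup.eq]
      convert V.one_mem using 1
      simp
  · rw [← MulAction.mem_stabilizer_iff, stabilizer_orb, mem_star, mem_star]
    simp only [MulAction.mem_stabilizer_iff, GSet.smul_mk_coset_eq, inv_one, one_mul, mul_one]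

theorem comp_coset_iso [Finite C] [Finite G] [Finite H] [Finite K]
    (U : Subgroup ((G × H) × C)) (V : Subgroup ((H × K) × C))
    (hU : ∀ h, ∃ g c, ((g, h), c) ∈ U) :
    (comp (GSet.coset U) (GSet.coset V)).Iso (freePart (GSet.coset (star U V))) :=
  (freePart_iso (coset_star_iso U V hU)).symm

/-- A subgroup of `G × C` is fibred if it meets `C` trivially. -/
def FibredSubgroup (S : Subgroup (G × C)) : Prop := ∀ c : C, ((1 : G), c) ∈ S → c = 1

theorem FibredSubgroup.isFibred [Finite C] [Finite G] {S : Subgroup (G × C)}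
    (h : FibredSubgroup S) : IsFibred (GSet.coset S) := by
  intro c x hx
  obtain ⟨g, rfl⟩ := QuotientGroup.mk_surjective x
  refine h c ?_
  rw [GSet.smul_mk_coset_eq] at hx
  convert hx using 1
  ext <;> simp [mul_comm g.2⁻¹]

theorem IsFibred.stabilizer {X : GSet (G × C)} (h : IsFibred X) (x : X) :
    FibredSubgroup (MulAction.stabilizer (G × C) x) := fun c hc => h c x hc

end Star

/-! ### Subgroups that do not factor through smaller groups -/

section Descent

variable {C G A : Type u} [CommGroup C] [Group G] [Group A] [hC : Fact (Nat.card C).Prime]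

/-- If `q : A → C` does not map the kernel of a surjection `p : A → G` onto `C`, then it factors
through `p`, and hence is trivial on the preimage of the Frattini subgroup. -/
theorem eq_one_of_mem_frattini {p : A →* G} (hp : Function.Surjective p) (q : A →* C)
    (h : ¬ ∀ c, ∃ a, p a = 1 ∧ q a = c) {a : A} (ha : p a ∈ frattini G) : q a = 1 := by
  have hb : p.ker.map q = ⊥ :=
    (p.ker.map q).eq_bot_or_eq_top_of_prime_card.resolve_right fun ht => h fun c => by
      have hc : c ∈ p.ker.map q := ht ▸ Subgroup.mem_top c
      exact hc
  rw [Subgroup.map_eq_bot_iff] at hb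
  have hl := p.liftOfRightInverse_comp_apply (Function.surjInv hp)
    (Function.rightInverse_surjInv hp) ⟨q, hb⟩ a
  rw [← hl]
  exact hom_frattini _ ha

end Descent

theorem card_ker_mul_card_range {A B : Type*} [Group A] [Group B] (f : A →* B) :
    Nat.card f.ker * Nat.card f.range = Nat.card A := by
  rw [← Subgroup.index_ker, Subgroup.card_mul_index]

theorem card_ker_mul_card_of_surjective {A B : Type*} [Group A] [Group B] {f : A →* B}
    (hf : Function.Surjective f) : Nat.card f.ker * Nat.card B = Nat.card A := by
  rw [← card_ker_mul_card_range f, MonoidHom.range_eq_top.2 hf, Subgroup.card_top]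

section Essential

variable {C G : Type u} [CommGroup C] [Group G]

/-- The subgroups of `(G × G) × C` that do not factor through a group of smaller order. -/
structure Essential (S : Subgroup ((G × G) × C)) : Prop where
  surj : ∀ g, ∃ h c, ((g, h), c) ∈ S
  ker : ∀ g, ((g, 1), 1) ∈ S → g = 1
  frattini : ∀ g c, ((g, 1), c) ∈ S → g ∈ frattini G

/-- Lift `g` to an element of `S`. Its commutator with `(z, 1, c)` is `([g, z], 1, 1)`, because `C`
is abelian, so `[g, z] = 1`. The Frattini condition is not among the hypotheses since the lemma also
serves where that condition fails. -/
theorem Essential.mem_center {S : Subgroup ((G × G) × C)} (hS : ∀ g, ∃ h c, ((g, h), c) ∈ S)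
    (hk : ∀ g, ((g, 1), 1) ∈ S → g = 1) {z : G} {c : C} (hz : ((z, 1), c) ∈ S) :
    z ∈ Subgroup.center G := by
  rw [Subgroup.mem_center_iff]
  intro g
  obtain ⟨h, d, hg⟩ := hS g
  have h1 := S.mul_mem (S.mul_mem (S.mul_mem hg hz) (S.inv_mem hg)) (S.inv_mem hz)
  have h2 := hk (g * z * g⁻¹ * z⁻¹) (by convert h1 using 1; simp)
  rw [mul_inv_eq_one, mul_inv_eq_iff_eq_mul] at h2
  exact h2

variable [hC : Fact (Nat.card C).Prime] [Finite C] [Finite G]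

/-- Essential subgroups do not occur in compositions through groups of smaller order. -/
theorem Essential.card_le {K : Type u} [Group K] [Finite K]
    {U : Subgroup ((G × K) × C)} {V : Subgroup ((K × G) × C)} (h : Essential (star U V)) :
    Nat.card G ≤ Nat.card K := by
  by_contra! hlt
  -- `A` consists of the elements of `U` that can be continued by an element of `V`. It maps onto
  -- `G`, and the goal is that it embeds in `K`.
  let A : Subgroup ((G × K) × C) := U ⊓
    (V.map ((MonoidHom.fst K G).comp (MonoidHom.fst (K × G) C))).comap
      ((MonoidHom.snd G K).comp (MonoidHom.fst (G × K) C))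
  have hA : ∀ a ∈ A, a.1.2 = 1 → ((a.1.1, 1), a.2) ∈ star U V := fun a ha h1 =>
    ⟨1, 1, by rw [mul_one, ← h1]; exact ha.1, by rw [inv_one]; exact V.one_mem⟩
  let p : A →* G := ((MonoidHom.fst G K).comp (MonoidHom.fst (G × K) C)).comp A.subtype
  let r : A →* K := ((MonoidHom.snd G K).comp (MonoidHom.fst (G × K) C)).comp A.subtype
  let q : A →* C := (MonoidHom.snd (G × K) C).comp A.subtype
  have hp : Function.Surjective p := by
    intro g
    obtain ⟨g', c, k, d, h1, h2⟩ := h.surj g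
    exact ⟨⟨((g, k), c * d), h1, _, h2, rfl⟩, rfl⟩
  -- The kernel of `r` embeds in `C`, by the second condition on `star U V`.
  have hr : Nat.card A ≤ Nat.card C * Nat.card K := by
    rw [← card_ker_mul_card_range r]
    refine Nat.mul_le_mul (Nat.card_le_card_of_injective (q.comp r.ker.subtype) ?_)
      (Subgroup.card_le_card_group _)
    rw [injective_iff_map_eq_one]
    rintro ⟨⟨⟨⟨g, k⟩, c⟩, ha⟩, hk⟩ (rfl : c = 1)
    obtain rfl : k = 1 := hk
    obtain rfl := h.ker g (hA _ ha rfl)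
    rfl
  -- If `q` mapped `ker p` onto `C`, then `|C||G| ≤ |A| ≤ |C||K|`, against `|K| < |G|`. Hence `q`
  -- factors through `p` and dies over `Φ(G)`.
  have hq : ∀ a : A, p a ∈ _root_.frattini G → q a = 1 := by
    refine fun a ha => eq_one_of_mem_frattini hp q (fun hc => ?_) ha
    choose f hf1 hf2 using hc
    have hle : Nat.card C ≤ Nat.card p.ker :=
      Nat.card_le_card_of_injective (fun c => (⟨f c, hf1 c⟩ : p.ker)) fun c d hcd => by
        rw [← hf2 c, ← hf2 d, Subtype.mk_eq_mk.1 hcd]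
    have h1 := card_ker_mul_card_of_surjective hp
    have h2 : Nat.card C * Nat.card K < Nat.card C * Nat.card G :=
      Nat.mul_lt_mul_of_pos_left hlt Nat.card_pos
    have h3 := Nat.mul_le_mul_right (Nat.card G) hle
    omega
  -- An element of `ker r` lies over `Φ(G)` by the third condition, so its `C`-component is trivial,
  -- and then the second condition makes it trivial.
  have hinj : Function.Injective r := by
    rw [injective_iff_map_eq_one]
    rintro ⟨⟨⟨g, k⟩, c⟩, ha⟩ (rfl : k = 1)
    have h1 := hA _ ha rfl
    obtain rfl : c = 1 := hq ⟨_, ha⟩ (h.frattini g c h1)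
    obtain rfl := h.ker g h1
    rfl
  exact hlt.not_ge ((Nat.card_le_card_of_surjective p hp).trans (Nat.card_le_card_of_injective r hinj))

end Essential

/-! ### Classification of the essential fibred subgroups -/

section Classification

variable {C G : Type u} [CommGroup C] [Group G]

/-- The subgroup `{(w(h), h, t(h))}` of `(G × G) × C`. -/
def graphSubgroup (w : MulAut G) (t : G →* C) : Subgroup ((G × G) × C) where
  carrier := {a | a.1.1 = w a.1.2 ∧ a.2 = t a.1.2}
  one_mem' := ⟨(map_one w).symm, (map_one t).symm⟩
  mul_mem' := by
    rintro a b ⟨h1, h2⟩ ⟨h3, h4⟩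
    exact ⟨by simp [h1, h3], by simp [h2, h4]⟩
  inv_mem' := by
    rintro a ⟨h1, h2⟩
    exact ⟨by simp [h1], by simp [h2]⟩

theorem mem_graphSubgroup {w : MulAut G} {t : G →* C} {a : (G × G) × C} :
    a ∈ graphSubgroup w t ↔ a.1.1 = w a.1.2 ∧ a.2 = t a.1.2 := Iff.rfl

/-- The subgroup `{(w(h) ζ(c)⁻¹, h, c)}` of `(G × G) × C`. -/
def twistSubgroup (w : MulAut G) (ζ : YSet C G) : Subgroup ((G × G) × C) where
  carrier := {a | a.1.1 * ζ.hom a.2 = w a.1.2}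
  one_mem' := by simp
  mul_mem' := by
    rintro a b h1 h2
    rw [Set.mem_ofPred_eq] at h1 h2 ⊢
    simp only [Prod.fst_mul, Prod.snd_mul, map_mul, ← h1, ← h2]
    rw [mul_assoc a.1.1, ← mul_assoc b.1.1, ζ.comm a.2 b.1.1]
    simp only [mul_assoc]
  inv_mem' := by
    rintro a h1
    rw [Set.mem_ofPred_eq] at h1 ⊢
    simp only [Prod.fst_inv, Prod.snd_inv, map_inv, ← h1, mul_inv_rev]
    rw [← map_inv, ζ.comm]

theorem mem_twistSubgroup {w : MulAut G} {ζ : YSet C G} {a : (G × G) × C} :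
    a ∈ twistSubgroup w ζ ↔ a.1.1 * ζ.hom a.2 = w a.1.2 := Iff.rfl

theorem essential_graphSubgroup (w : MulAut G) (t : G →* C) : Essential (graphSubgroup w t) where
  surj g := ⟨w.symm g, t (w.symm g), (w.apply_symm_apply g).symm, rfl⟩
  ker g h := h.1.trans (map_one w)
  frattini g c h := by
    rw [show g = 1 from h.1.trans (map_one w)]
    exact one_mem _

/-- The elements `(g, 1, c)` are those with `g = ζ(c)⁻¹`; this is where `ζ(C) ≤ Φ(G)` is needed. -/
theorem essential_twistSubgroup (w : MulAut G) (ζ : YSet C G) : Essential (twistSubgroup w ζ) where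
  surj g := ⟨w.symm g, 1, by simp [mem_twistSubgroup]⟩
  ker g h := by simpa [mem_twistSubgroup] using h
  frattini g c h := by
    have h1 : g * ζ.hom c = 1 := h.trans (map_one w)
    rw [mul_eq_one_iff_eq_inv] at h1
    rw [h1]
    exact inv_mem (ζ.mem c).2

theorem fibred_graphSubgroup (w : MulAut G) (t : G →* C) :
    FibredSubgroup (graphSubgroup w t) := fun _ h => h.2.trans (map_one t)

theorem fibred_twistSubgroup (w : MulAut G) (ζ : YSet C G) :
    FibredSubgroup (twistSubgroup w ζ) := fun c h => by
  have h1 : (1 : G) * ζ.hom c = 1 := h.trans (map_one w)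
  rw [one_mul] at h1
  exact ζ.injective (h1.trans (map_one _).symm)

variable [hC : Fact (Nat.card C).Prime] [Finite C] [Finite G]

/-- The dichotomy is whether `S` contains some `(z, 1, c)` with `c ≠ 1`. If not, both projections to
`G` are bijective on `S`, which is a graph. If so, `|S| = |C||G|`, the part of `S` with trivial
`C`-component is the graph of an automorphism `w`, and the part with trivial second coordinate is a
copy of `C` that gives `ζ`. -/
theorem Essential.eq_graph_or_twist {S : Subgroup ((G × G) × C)} (hS : Essential S)
    (hf : FibredSubgroup S) :
    (∃ w t, S = graphSubgroup w t) ∨ ∃ w ζ, S = twistSubgroup w ζ := by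
  let p : S →* G := ((MonoidHom.fst G G).comp (MonoidHom.fst (G × G) C)).comp S.subtype
  let r : S →* G := ((MonoidHom.snd G G).comp (MonoidHom.fst (G × G) C)).comp S.subtype
  let q : S →* C := (MonoidHom.snd (G × G) C).comp S.subtype
  have hp : Function.Surjective p := fun g =>
    have ⟨h, c, hg⟩ := hS.surj g
    ⟨⟨_, hg⟩, rfl⟩
  have hrq : ∀ s, r s = 1 → q s = 1 → s = 1 := by
    rintro ⟨⟨⟨g, h⟩, c⟩, ha⟩ (rfl : h = 1) (rfl : c = 1)
    obtain rfl := hS.ker g ha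
    rfl
  by_cases hker : ∀ s, r s = 1 → q s = 1
  · left
    have hri : Function.Injective r :=
      (injective_iff_map_eq_one r).2 fun s h => hrq s h (hker s h)
    have hcard : Nat.card S = Nat.card G :=
      le_antisymm (Nat.card_le_card_of_injective r hri) (Nat.card_le_card_of_surjective p hp)
    have hrb := (Nat.bijective_iff_injective_and_card r).2 ⟨hri, hcard⟩
    have hpb := (Nat.bijective_iff_surjective_and_card p).2 ⟨hp, hcard⟩
    let e := MulEquiv.ofBijective r hrb
    refine ⟨e.symm.trans (MulEquiv.ofBijective p hpb), q.comp e.symm.toMonoidHom, ?_⟩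
    ext a
    rw [mem_graphSubgroup]
    constructor
    · intro ha
      have h1 : e.symm a.1.2 = ⟨a, ha⟩ := e.symm_apply_eq.2 rfl
      simp [h1, p, q]
    · rintro ⟨h1, h2⟩
      obtain ⟨s, hs⟩ := hrb.2 a.1.2
      have h3 : e.symm a.1.2 = s := e.symm_apply_eq.2 hs.symm
      simp only [MulEquiv.trans_apply, h3, MulEquiv.ofBijective_apply, MonoidHom.comp_apply,
        MulEquiv.toMonoidHom_eq_coe, MonoidHom.coe_coe] at h1 h2
      have h4 : a = s.1 := Prod.ext (Prod.ext h1 hs.symm) h2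
      exact h4 ▸ s.2
  · right
    push Not at hker
    obtain ⟨⟨⟨⟨z, h⟩, c⟩, hz⟩, hz1, hz2⟩ := hker
    obtain rfl : h = 1 := hz1
    -- Otherwise `q` would be trivial over `Φ(G)`, where `z` lies, contrary to the choice of `(z, 1,
    -- c)`.
    have hc : ∀ c, ∃ a, p a = 1 ∧ q a = c := by
      by_contra hc
      exact hz2 (eq_one_of_mem_frattini hp q hc (hS.frattini z c hz))
    choose f hf1 hf2 using hc
    let f' : C → p.ker := fun c => ⟨f c, hf1 c⟩
    have hfi : Function.Injective f' := fun c d hcd => by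
      rw [← hf2 c, ← hf2 d, Subtype.mk_eq_mk.1 hcd]
    let k : r.ker →* C := q.comp r.ker.subtype
    have hki : Function.Injective k :=
      (injective_iff_map_eq_one k).2 fun s h => Subtype.ext (hrq s.1 s.2 h)
    have h1 := Nat.card_le_card_of_injective f' hfi
    have h2 := Nat.card_le_card_of_injective k hki
    have h3 := card_ker_mul_card_of_surjective hp
    have h4 := card_ker_mul_card_range r
    have h5 := Subgroup.card_le_card_group r.range
    have hG : 0 < Nat.card G := Nat.card_pos
    -- With `|ker r| ≤ |C|` and `|range r| ≤ |G|` this is a sandwich, so all the inequalities are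
    -- equalities: `q` identifies both `ker p` and `ker r` with `C`, and `r` is onto.
    have h6 : Nat.card C * Nat.card G ≤ Nat.card r.ker * Nat.card r.range :=
      (Nat.mul_le_mul_right _ h1).trans (h3.trans h4.symm).le
    have h7 : Nat.card C ≤ Nat.card r.ker :=
      Nat.le_of_mul_le_mul_right (h6.trans (Nat.mul_le_mul_left _ h5)) hG
    have h8 : Nat.card G ≤ Nat.card r.range :=
      Nat.le_of_mul_le_mul_left (h6.trans (Nat.mul_le_mul_right _ h2)) Nat.card_pos
    have h9 : Nat.card p.ker ≤ Nat.card C :=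
      Nat.le_of_mul_le_mul_right ((h3.trans h4.symm).le.trans (Nat.mul_le_mul h2 h5)) hG
    have hr : Function.Surjective r :=
      MonoidHom.range_eq_top.1 (Subgroup.eq_top_of_le_card _ h8)
    have hkb := (Nat.bijective_iff_injective_and_card k).2 ⟨hki, le_antisymm h2 h7⟩
    have hfb := (Nat.bijective_iff_injective_and_card f').2 ⟨hfi, le_antisymm h1 h9⟩
    have hpq : ∀ s, p s = 1 → q s = 1 → s = 1 := by
      have hfq : ∀ s, p s = 1 → f (q s) = s := by
        intro s hs
        obtain ⟨c, hc⟩ := hfb.2 ⟨s, hs⟩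
        obtain rfl : f c = s := congrArg Subtype.val hc
        rw [hf2]
      intro s hs hs'
      rw [← hfq s hs, hs', ← map_one q, hfq 1 (map_one p)]
    -- On `ker q` both projections to `G` become isomorphisms, and `w` is one after the inverse of
    -- the other.
    let p₀ : q.ker →* G := p.comp q.ker.subtype
    let r₀ : q.ker →* G := r.comp q.ker.subtype
    have hp₀ : Function.Injective p₀ :=
      (injective_iff_map_eq_one p₀).2 fun s h => Subtype.ext (hpq s.1 h s.2)
    have hr₀ : Function.Bijective r₀ := by
      refine ⟨(injective_iff_map_eq_one r₀).2 fun s h => Subtype.ext (hrq s.1 h s.2), fun h => ?_⟩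
      obtain ⟨s, hs⟩ := hr h
      obtain ⟨s', hs'⟩ := hkb.2 (q s)
      refine ⟨⟨s'.1⁻¹ * s, ?_⟩, ?_⟩
      · rw [MonoidHom.mem_ker, map_mul, map_inv, show q s'.1 = q s from hs', inv_mul_cancel]
      · show r (s'.1⁻¹ * s) = h
        rw [map_mul, map_inv, show r s'.1 = 1 from s'.2, hs, inv_one, one_mul]
    have hp₀' := (Nat.bijective_iff_injective_and_card p₀).2
      ⟨hp₀, Nat.card_congr (Equiv.ofBijective r₀ hr₀)⟩
    let e := MulEquiv.ofBijective r₀ hr₀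
    let w : MulAut G := e.symm.trans (MulEquiv.ofBijective p₀ hp₀')
    have hw : ∀ h, ((w h, h), 1) ∈ S := by
      intro h
      obtain ⟨s, rfl⟩ := e.surjective h
      convert s.1.2 using 1
      refine Prod.ext (Prod.ext ?_ rfl) s.2.symm
      show MulEquiv.ofBijective p₀ hp₀' (e.symm (e s)) = _
      rw [e.symm_apply_apply]
      rfl
    let kE := MulEquiv.ofBijective k hkb
    -- The inversion matches the sign in `twistSubgroup`, whose elements over `1` and `c` have first
    -- coordinate `ζ(c)⁻¹`.
    let ζ₀ : C →* G := ((p.comp r.ker.subtype).comp kE.symm.toMonoidHom).comp invMonoidHom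
    have hζ : ∀ c, (((ζ₀ c)⁻¹, 1), c) ∈ S := by
      intro c
      obtain ⟨s, rfl⟩ := kE.surjective c
      convert s.1.2 using 1
      refine Prod.ext (Prod.ext ?_ s.2.symm) rfl
      show (p (kE.symm (kE s)⁻¹).1)⁻¹ = _
      rw [map_inv, kE.symm_apply_apply, InvMemClass.coe_inv, map_inv, inv_inv]
      rfl
    let ζ : YSet C G :=
      { hom := ζ₀
        -- If `ζ₀ c = 1`, then `(1, 1, c) ∈ S`, and `S` meets `C` trivially.
        injective := (injective_iff_map_eq_one ζ₀).2 fun c hc => hf c (by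
          have := hζ c
          rwa [hc, inv_one] at this)
        mem := fun c => ⟨(Subgroup.center G).inv_mem_iff.1 (Essential.mem_center hS.surj hS.ker (hζ c)),
          (_root_.frattini G).inv_mem_iff.1 (hS.frattini _ _ (hζ c))⟩ }
    refine ⟨w, ζ, ?_⟩
    ext a
    rw [mem_twistSubgroup]
    constructor
    · intro ha
      -- Dividing `a` by the elements of `S` found above leaves one of the form `(g, 1, 1)`, which
      -- must be trivial.
      have h10 := S.mul_mem (S.mul_mem ha (S.inv_mem (hζ a.2))) (S.inv_mem (hw a.1.2))
      have h11 := hS.ker (a.1.1 * ζ₀ a.2 * (w a.1.2)⁻¹) (by convert h10 using 1; ext <;> simp)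
      exact mul_inv_eq_one.1 h11
    · intro ha
      convert S.mul_mem (hw a.1.2) (hζ a.2) using 1
      rw [← ha]
      ext <;> simp [ζ]

end Classification

/-! ### Composites of graphs and twisted subgroups -/

section Products

variable {C G : Type u} [CommGroup C] [Group G]

theorem star_graph_graph (w w' : MulAut G) (t t' : G →* C) :
    star (graphSubgroup w t) (graphSubgroup w' t') =
      graphSubgroup (w * w') (t.comp w'.toMonoidHom * t') := by
  ext a
  simp only [mem_star, mem_graphSubgroup, MulAut.mul_apply, MonoidHom.mul_apply,
    MonoidHom.comp_apply, MulEquiv.toMonoidHom_eq_coe, MonoidHom.coe_coe]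
  constructor
  · rintro ⟨h, d, ⟨h1, h2⟩, h3, h4⟩
    rw [← h3, ← h4, ← h2, mul_inv_cancel_right]
    exact ⟨h1, rfl⟩
  · rintro ⟨h1, h2⟩
    exact ⟨w' a.1.2, (t' a.1.2)⁻¹, ⟨h1, by rw [h2, mul_inv_cancel_right]⟩, rfl, inv_inv _⟩

theorem diag_eq_graph : diag C G = graphSubgroup 1 1 := rfl

variable [hC : Fact (Nat.card C).Prime]

/-- The middle element is `h = w'(k) ζ(d)`, and `t` kills `ζ(C)`, so `t(h) = t(w'(k))`. This
determines `d = a.2⁻¹ t(w'(k))`; eliminating `h` and `d` produces the twist of `w'`. -/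
theorem star_graph_twist (w w' : MulAut G) (t : G →* C) (ζ : YSet C G) :
    star (graphSubgroup w t) (twistSubgroup w' ζ) =
      twistSubgroup (w * twistAut w' ζ (t.comp w'.toMonoidHom)) (ζ.aut w) := by
  ext a
  simp only [mem_star, mem_graphSubgroup, mem_twistSubgroup, MulAut.mul_apply, twistAut_apply,
    MonoidHom.comp_apply, MulEquiv.toMonoidHom_eq_coe, MonoidHom.coe_coe, YSet.aut]
  constructor
  · rintro ⟨h, d, ⟨h1, h2⟩, h3⟩
    rw [← h3, map_mul t, ζ.hom_comp, mul_one, ← h2, h1, ← map_mul w, mul_assoc, ← map_mul,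
      mul_comm a.2, inv_mul_cancel_left]
  · intro h1
    have h2 : w.symm a.1.1 * ζ.hom a.2 = w' a.1.2 * ζ.hom (t (w' a.1.2)) := by
      apply w.injective
      rw [map_mul w, MulEquiv.apply_symm_apply, h1]
    have h3 : t (w.symm a.1.1) = t (w' a.1.2) := by
      simpa using congrArg t h2
    refine ⟨w.symm a.1.1, a.2⁻¹ * t (w' a.1.2), ⟨(w.apply_symm_apply _).symm, ?_⟩, ?_⟩
    · rw [mul_inv_cancel_left, h3]
    · rw [mul_inv_rev, inv_inv, mul_comm, map_mul, ← mul_assoc, h2, map_inv, mul_inv_cancel_right]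

/-- The graph forces `d = t(k)⁻¹`, and this contributes the factor `ζ(t(k))`. -/
theorem star_twist_graph (w w' : MulAut G) (t : G →* C) (ζ : YSet C G) :
    star (twistSubgroup w ζ) (graphSubgroup w' t) =
      twistSubgroup (twistAut (w * w') ζ t) ζ := by
  ext a
  simp only [mem_star, mem_graphSubgroup, mem_twistSubgroup, MulAut.mul_apply, twistAut_apply]
  constructor
  · rintro ⟨h, d, h1, rfl, h3⟩
    rw [← h3, ← h1, mul_assoc, ← map_mul, mul_inv_cancel_right]
  · intro h1
    refine ⟨w' a.1.2, (t a.1.2)⁻¹, ?_, rfl, inv_inv _⟩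
    rw [map_mul, ← mul_assoc, h1, map_inv, mul_inv_cancel_right]

omit hC in
-- When the first parameter is `w ∘ χ`, the contributions of `d` on the two sides cancel, so `d` may
-- be taken to be `1`.
theorem star_twist_twist (w w' : MulAut G) (χ : YSet C G) :
    star (twistSubgroup w (χ.aut w)) (twistSubgroup w' χ) =
      twistSubgroup (w * w') (χ.aut w) := by
  ext a
  simp only [mem_star, mem_twistSubgroup, MulAut.mul_apply,
    MonoidHom.comp_apply, MulEquiv.toMonoidHom_eq_coe, MonoidHom.coe_coe, YSet.aut]
  constructor
  · rintro ⟨h, d, h1, h2⟩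
    rw [← h2, map_mul w, ← h1, mul_assoc, ← map_mul w, ← map_mul, mul_inv_cancel_right]
  · intro h1
    exact ⟨w' a.1.2, 1, by rw [mul_one, h1], by rw [inv_one, map_one, mul_one]⟩

end Products

/-! ### Conjugacy classes of these subgroups -/

section Conjugacy

variable {C G : Type u} [CommGroup C] [Group G]

theorem out_mk_eq_of_conj {w w' : MulAut G} {a b : G}
    (h : ∀ x, a⁻¹ * w x * a = w' (b⁻¹ * x * b)) :
    (QuotientGroup.mk w : Out G) = QuotientGroup.mk w' := by
  -- Solving the hypothesis for `w x` gives conjugation by `a w'(b)⁻¹` applied to `w' x`.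
  rw [← out_mk_conj_mul (a * (w' b)⁻¹) w']
  congr 1
  ext x
  have h1 := h x
  rw [mul_assoc, inv_mul_eq_iff_eq_mul, ← eq_mul_inv_iff_mul_eq] at h1
  simp only [MulAut.mul_apply, MulAut.conj_apply, h1]
  simp only [map_mul, map_inv]
  group

/-- Changing the representative of an outer automorphism conjugates the subgroup, by an element of
the first factor. -/
theorem graph_conj_iff (w : MulAut G) (t : G →* C) (g : G) (a : (G × G) × C) :
    a ∈ graphSubgroup (MulAut.conj g * w) t ↔
      (((g, 1), 1) : (G × G) × C)⁻¹ * a * ((g, 1), 1) ∈ graphSubgroup w t := by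
  simp only [mem_graphSubgroup, MulAut.mul_apply, MulAut.conj_apply, Prod.fst_mul, Prod.snd_mul,
    Prod.fst_inv, Prod.snd_inv, inv_one, one_mul, mul_one]
  rw [eq_mul_inv_iff_mul_eq, mul_assoc, inv_mul_eq_iff_eq_mul]

theorem twist_conj_iff (w : MulAut G) (ζ : YSet C G) (g : G) (a : (G × G) × C) :
    a ∈ twistSubgroup (MulAut.conj g * w) ζ ↔
      (((g, 1), 1) : (G × G) × C)⁻¹ * a * ((g, 1), 1) ∈ twistSubgroup w ζ := by
  simp only [mem_twistSubgroup, MulAut.mul_apply, MulAut.conj_apply, Prod.fst_mul, Prod.snd_mul,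
    Prod.fst_inv, Prod.snd_inv, inv_one, one_mul, mul_one]
  rw [eq_mul_inv_iff_mul_eq, mul_assoc, ← ζ.comm, mul_assoc (g⁻¹ * a.1.1), mul_assoc g⁻¹,
    inv_mul_eq_iff_eq_mul]

theorem eq_of_graph_conj {w w' : MulAut G} {t t' : G →* C} {γ : (G × G) × C}
    (h : ∀ a, a ∈ graphSubgroup w t ↔ γ⁻¹ * a * γ ∈ graphSubgroup w' t') :
    (QuotientGroup.mk w : Out G) = QuotientGroup.mk w' ∧ t = t' := by
  have h1 := fun x => (h ((w x, x), t x)).1 ⟨rfl, rfl⟩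
  refine ⟨out_mk_eq_of_conj fun x => (h1 x).1, ?_⟩
  ext x
  simpa [mul_comm] using (h1 x).2

theorem eq_of_twist_conj {w w' : MulAut G} {ζ ζ' : YSet C G} {γ : (G × G) × C}
    (h : ∀ a, a ∈ twistSubgroup w ζ ↔ γ⁻¹ * a * γ ∈ twistSubgroup w' ζ') :
    (QuotientGroup.mk w : Out G) = QuotientGroup.mk w' ∧ ζ = ζ' := by
  constructor
  · refine out_mk_eq_of_conj (a := γ.1.1) (b := γ.1.2) fun x => ?_
    simpa [mem_twistSubgroup] using (h ((w x, x), 1)).1 (by simp [mem_twistSubgroup])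
  · ext c
    -- The values of `ζ` are central, so these elements are unchanged by conjugation and can be
    -- compared directly.
    have h1 := (h (((ζ.hom c)⁻¹, 1), c)).1 (by simp [mem_twistSubgroup])
    have h2 : (γ.1.1)⁻¹ * (ζ.hom c)⁻¹ * γ.1.1 = (ζ.hom c)⁻¹ := by
      rw [← map_inv, ζ.comm, inv_mul_cancel_right]
    simp only [mem_twistSubgroup, Prod.fst_mul, Prod.snd_mul, Prod.fst_inv, Prod.snd_inv, h2,
      mul_one, inv_mul_cancel, map_one, mul_comm _ γ.2, mul_inv_cancel_left] at h1
    exact inv_mul_eq_one.1 h1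

variable [Finite C] [hC : Fact (Nat.card C).Prime]

/-- A twisted subgroup contains elements `(ζ(c)⁻¹, 1, c)` with `c ≠ 1`. In a graph, second
coordinate `1` forces trivial `C`-component, and this property survives conjugation. -/
theorem not_graph_conj_twist {w w' : MulAut G} {t : G →* C} {ζ : YSet C G} (γ : (G × G) × C) :
    ¬ ∀ a, a ∈ graphSubgroup w t ↔ γ⁻¹ * a * γ ∈ twistSubgroup w' ζ := by
  intro h
  have := Finite.one_lt_card_iff_nontrivial.1 hC.out.one_lt
  obtain ⟨c, hc⟩ := exists_ne (1 : C)
  have h1 := (h (γ * (((ζ.hom c)⁻¹, 1), c) * γ⁻¹)).2 (by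
    rw [show γ⁻¹ * (γ * (((ζ.hom c)⁻¹, 1), c) * γ⁻¹) * γ = (((ζ.hom c)⁻¹, 1), c) by group]
    simp [mem_twistSubgroup])
  refine hc ?_
  simpa [mem_graphSubgroup, mul_comm γ.2] using h1.2

theorem not_twist_conj_graph {w w' : MulAut G} {t : G →* C} {ζ : YSet C G} (γ : (G × G) × C) :
    ¬ ∀ a, a ∈ twistSubgroup w' ζ ↔ γ⁻¹ * a * γ ∈ graphSubgroup w t := by
  intro h
  refine not_graph_conj_twist (w := w) (t := t) (w' := w') (ζ := ζ) γ⁻¹ fun a => ?_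
  rw [h, inv_inv]
  rw [show γ⁻¹ * (γ * a * γ⁻¹) * γ = a by group]

end Conjugacy

/-! ### Which classes lie in the ideal of smaller groups -/

section Factor

variable (R : Type v) [CommRing R] {C G H K : Type u} [CommGroup C] [Group G] [Group H] [Group K]
  [Finite C] [Finite G] [Finite H] [Finite K]

/-- The class of the `C`-free part of a finite `(G × C)`-set. -/
def freeCls (X : GSet (G × C)) : MonomialBurnside R C G :=
  ⟨cls R (freePart X), Submodule.subset_span ⟨_, freePart_isFibred X, rfl⟩⟩

omit [Finite C] [Finite G] in
theorem freeCls_val_of_isFibred {X : GSet (G × C)} (h : IsFibred X) :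
    (freeCls R X).1 = cls R X := cls_iso R (freePart_iso_self h)

omit [Finite C] [Finite G] in
theorem freeCls_iso {X Y : GSet (G × C)} (h : X.Iso Y) : freeCls R X = freeCls R Y :=
  Subtype.ext (cls_iso R (freePart_iso h))

/-- Passing to free parts before composing changes nothing, so the formula holds even when the
subgroups meet `C` nontrivially; the free part is then empty and the class is zero. -/
theorem mcomp_freeCls_coset (U : Subgroup ((G × H) × C)) (V : Subgroup ((H × K) × C))
    (hU : ∀ h, ∃ g c, ((g, h), c) ∈ U) :
    mcomp (freeCls R (GSet.coset U)) (freeCls R (GSet.coset V)) =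
      freeCls R (GSet.coset (star U V)) := by
  refine Subtype.ext ?_
  change compLin (cls R _) (cls R _) = cls R _
  rw [compLin_cls]
  exact cls_iso R (((comp_freePart_left _ _).trans (comp_freePart_right _ _)).trans
    (comp_coset_iso U V hU))

theorem freeCls_star_mem (hK : Nat.card K < Nat.card G) (U : Subgroup ((G × K) × C))
    (V : Subgroup ((K × G) × C)) (hU : ∀ h, ∃ g c, ((g, h), c) ∈ U) :
    (freeCls R (GSet.coset (star U V)) : EndAlg R C G) ∈ factorSubmodule R C G :=
  Submodule.subset_span ⟨K, _, inferInstance, hK, _, _, (mcomp_freeCls_coset R U V hU).symm⟩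

/-- Modulo the elements `(z, 1, c)` coming from `Z`, every element of `S` has first coordinate in
`M`. Hence `S` is the composite of `{(g, m, c) | (m⁻¹ g, c) ∈ Z}` with the part of `S` over `M`;
centrality of `Z` makes the former a subgroup. The auxiliary `Z` allows `M` to be smaller than the
first projection of `S`. -/
theorem freeCls_mem_of_subgroup {S : Subgroup ((G × G) × C)} {M : Subgroup G} (hM : M ≠ ⊤)
    (Z : Subgroup (G × C)) (hZ : ∀ z ∈ Z, z.1 ∈ Subgroup.center G)
    (hZS : ∀ z ∈ Z, ((z.1, 1), z.2) ∈ S)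
    (hS : ∀ a ∈ S, ∃ m ∈ M, ∃ z ∈ Z, a.1.1 = m * z.1) :
    (freeCls R (GSet.coset S) : EndAlg R C G) ∈ factorSubmodule R C G := by
  let U : Subgroup ((G × M) × C) :=
    { carrier := {a | ((a.1.2 : G)⁻¹ * a.1.1, a.2) ∈ Z}
      one_mem' := by
        rw [Set.mem_ofPred_eq, Prod.fst_one, Prod.fst_one, Prod.snd_one, OneMemClass.coe_one,
          inv_one, one_mul]
        exact Z.one_mem
      mul_mem' := by
        intro a b ha hb
        rw [Set.mem_ofPred_eq] at ha hb ⊢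
        convert Z.mul_mem ha hb using 1
        refine Prod.ext ?_ rfl
        have := Subgroup.mem_center_iff.1 (hZ _ ha) (b.1.2 : G)⁻¹
        simp only [Prod.fst_mul, Prod.snd_mul, Subgroup.coe_mul, mul_inv_rev] at this ⊢
        simpa only [mul_assoc] using congrArg (· * b.1.1) this
      inv_mem' := by
        intro a ha
        rw [Set.mem_ofPred_eq] at ha ⊢
        convert Z.inv_mem ha using 1
        refine Prod.ext ?_ rfl
        have := Subgroup.mem_center_iff.1 (inv_mem (hZ _ ha)) (a.1.2 : G)
        simp only [Prod.fst_inv, Prod.snd_inv, Subgroup.coe_inv, mul_inv_rev, inv_inv] at this ⊢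
        rw [← mul_right_cancel_iff (a := (a.1.2 : G)), mul_assoc, this] }
  let V : Subgroup ((M × G) × C) :=
    S.comap ((M.subtype.prodMap (MonoidHom.id G)).prodMap (MonoidHom.id C))
  have hUV : star U V = S := by
    ext a
    constructor
    · rintro ⟨m, d, h1, h2⟩
      have h3 := S.mul_mem (show ((m.1, a.1.2), d⁻¹) ∈ S from h2) (hZS _ h1)
      convert h3 using 1
      ext <;> simp [mul_comm d⁻¹]
    · intro ha
      obtain ⟨m, hm, z, hz, h1⟩ := hS a ha
      refine ⟨⟨m, hm⟩, z.2 * a.2⁻¹, ?_, ?_⟩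
      · show (m⁻¹ * a.1.1, a.2 * (z.2 * a.2⁻¹)) ∈ Z
        convert hz using 1
        ext <;> simp [h1, mul_comm z.2]
      · show ((m, a.1.2), (z.2 * a.2⁻¹)⁻¹) ∈ S
        convert S.mul_mem ha (S.inv_mem (hZS z hz)) using 1
        ext <;> simp [h1]
  rw [← hUV]
  refine freeCls_star_mem R ?_ U V fun m => ⟨m, 1, ?_⟩
  · exact lt_of_le_of_ne (Subgroup.card_le_card_group M) fun h =>
      hM (Subgroup.eq_top_of_card_eq M h)
  · show ((m : G)⁻¹ * m, (1 : C)) ∈ Z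
    rw [inv_mul_cancel]
    exact Z.one_mem

/-- As `S` absorbs `N` in its first coordinate, it is recovered from its image over `G ⧸ N` by
composing with the graph of the quotient map. -/
theorem freeCls_mem_of_normal {S : Subgroup ((G × G) × C)} (N : Subgroup G) [N.Normal]
    (hN : N ≠ ⊥) (hNS : ∀ n ∈ N, ((n, 1), 1) ∈ S) :
    (freeCls R (GSet.coset S) : EndAlg R C G) ∈ factorSubmodule R C G := by
  let U : Subgroup ((G × (G ⧸ N)) × C) :=
    { carrier := {a | QuotientGroup.mk' N a.1.1 = a.1.2 ∧ a.2 = 1}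
      one_mem' := ⟨map_one _, rfl⟩
      mul_mem' := by
        rintro a b ⟨h1, h2⟩ ⟨h3, h4⟩
        exact ⟨by simp only [Prod.fst_mul, Prod.snd_mul, map_mul, h1, h3], by simp [h2, h4]⟩
      inv_mem' := by
        rintro a ⟨h1, h2⟩
        exact ⟨by simp only [Prod.fst_inv, Prod.snd_inv, map_inv, h1], by simp [h2]⟩ }
  let V : Subgroup (((G ⧸ N) × G) × C) :=
    S.map (((QuotientGroup.mk' N).prodMap (MonoidHom.id G)).prodMap (MonoidHom.id C))
  have hUV : star U V = S := by
    ext a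
    constructor
    · rintro ⟨h, d, ⟨h0, h1⟩, ⟨⟨⟨g, g'⟩, c⟩, hs, h2⟩⟩
      obtain rfl : QuotientGroup.mk' N a.1.1 = h := h0
      obtain ⟨⟨h3, rfl⟩, rfl⟩ : (QuotientGroup.mk' N g = QuotientGroup.mk' N a.1.1 ∧
          g' = a.1.2) ∧ c = d⁻¹ := by simpa [Prod.ext_iff] using h2
      have h4 := S.mul_mem hs (hNS _ (QuotientGroup.eq.1 h3))
      convert h4 using 1
      refine Prod.ext (Prod.ext ?_ ?_) ?_
      · simp
      · simp
      · simpa using eq_inv_of_mul_eq_one_left h1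
    · intro ha
      exact ⟨QuotientGroup.mk' N a.1.1, a.2⁻¹, ⟨rfl, mul_inv_cancel _⟩, a, ha,
        Prod.ext rfl (inv_inv _).symm⟩
  rw [← hUV]
  refine freeCls_star_mem R ?_ U V fun h => ?_
  · have h1 := Subgroup.card_eq_card_quotient_mul_card_subgroup N
    have h2 := N.one_lt_card_iff_ne_bot.2 hN
    rw [h1]
    exact lt_mul_of_one_lt_right Nat.card_pos h2
  · obtain ⟨g, rfl⟩ := QuotientGroup.mk_surjective h
    exact ⟨g, 1, rfl, rfl⟩

theorem freeCls_mem_of_not_essential {S : Subgroup ((G × G) × C)} (h : ¬ Essential S) :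
    (freeCls R (GSet.coset S) : EndAlg R C G) ∈ factorSubmodule R C G := by
  by_cases hs : ∀ g, ∃ h c, ((g, h), c) ∈ S
  swap
  -- The first projection of `S` is a proper subgroup, through which `S` factors with `Z` trivial.
  · refine freeCls_mem_of_subgroup R
      (M := S.map ((MonoidHom.fst G G).comp (MonoidHom.fst (G × G) C))) (fun ht => hs fun g => ?_)
      ⊥ ?_ ?_ fun a ha => ⟨a.1.1, ⟨a, ha, rfl⟩, 1, one_mem _, (mul_one _).symm⟩
    · obtain ⟨a, ha, rfl⟩ := ht ▸ Subgroup.mem_top g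
      exact ⟨_, _, ha⟩
    · rintro z rfl
      exact one_mem _
    · rintro z rfl
      exact one_mem _
  by_cases hk : ∀ g, ((g, 1), 1) ∈ S → g = 1
  swap
  -- This kernel is normal because `S` projects onto `G`.
  · let N : Subgroup G := S.comap ((MonoidHom.inl (G × G) C).comp (MonoidHom.inl G G))
    have : N.Normal := by
      refine ⟨fun n hn g => ?_⟩
      obtain ⟨g', c, hg⟩ := hs g
      have h1 := S.mul_mem (S.mul_mem hg (show ((n, 1), 1) ∈ S from hn)) (S.inv_mem hg)
      show ((g * n * g⁻¹, 1), 1) ∈ S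
      convert h1 using 1
      simp
    refine freeCls_mem_of_normal R N (fun hb => hk fun g hg => ?_) fun n hn => hn
    have : g ∈ N := hg
    rwa [hb] at this
  have hf : ¬ ∀ g c, ((g, 1), c) ∈ S → g ∈ frattini G := fun hf => h ⟨hs, hk, hf⟩
  push Not at hf
  obtain ⟨z, c, hz, hzf⟩ := hf
  have hzc := Essential.mem_center hs hk hz
  -- As `z ∉ Φ(G)`, some maximal subgroup `M` omits `z`. Since `z` is central, `M⟨z⟩ = G`, and `S`
  -- factors through `M` with `Z = ⟨(z, c)⟩`.
  obtain ⟨M, hM, hzM⟩ : ∃ M : Subgroup G, IsCoatom M ∧ z ∉ M := by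
    by_contra! hall
    refine hzf ?_
    rw [frattini, Order.radical, Subgroup.mem_iInf]
    exact fun M => Subgroup.mem_iInf.2 fun hM => hall M hM
  refine freeCls_mem_of_subgroup R hM.1 (Subgroup.zpowers (z, c)) ?_ ?_ fun a _ => ?_
  · rintro _ ⟨i, rfl⟩
    exact zpow_mem hzc i
  · rintro _ ⟨i, rfl⟩
    convert S.zpow_mem hz i using 1
    simp
  · have hn : (Subgroup.zpowers z).Normal := by
      refine ⟨?_⟩
      rintro _ ⟨i, rfl⟩ g
      beta_reduce
      rw [Subgroup.mem_center_iff.1 (zpow_mem hzc i) g, mul_inv_cancel_right]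
      exact ⟨i, rfl⟩
    have ht : M ⊔ Subgroup.zpowers z = ⊤ := hM.2 _ (left_lt_sup.2 (by simpa using hzM))
    obtain ⟨m, hm, _, ⟨i, rfl⟩, h1⟩ := Subgroup.mem_sup_of_normal_right.1
      (ht ▸ Subgroup.mem_top a.1.1)
    exact ⟨m, hm, (z, c) ^ i, ⟨i, rfl⟩, h1.symm⟩

variable [hC : Fact (Nat.card C).Prime]

/-- Every point of a composition through `K` has a stabilizer of the form `star U V`, which is not
essential when `|K| < |G|`; so no orbit of type `S` occurs. -/
theorem orbitCount_eq_zero_of_mem {S : Subgroup ((G × G) × C)} (hS : Essential S)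
    {x : EndAlg R C G} (hx : x ∈ factorSubmodule R C G) : orbitCount R S x.1 = 0 := by
  induction hx using Submodule.span_induction with
  | mem x hx =>
    obtain ⟨K, _, _, hK, a, b, rfl⟩ := hx
    have h : compLin.compr₂ (orbitCount R S) =
        (0 : Burnside R ((G × K) × C) →ₗ[R] Burnside R ((K × G) × C) →ₗ[R] R) := by
      refine Burnside.hom_ext fun T => Burnside.hom_ext fun Y => ?_
      rw [LinearMap.compr₂_apply, compLin_cls, orbitCount_cls, GSet.orbitsOfType,
        Set.eq_empty_of_forall_notMem (s := {x | _}), Set.image_empty, Set.ncard_empty]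
      · simp
      · intro x hx
        rw [Set.mem_ofPred_eq, ← GSet.stabilizer_image (X := comp T Y) (Y := orbSet T Y)
          Subtype.val_injective (fun _ _ => rfl)] at hx
        obtain ⟨t, y, h1⟩ := orb_surj x.1
        rw [← h1, stabilizer_orb] at hx
        exact hK.not_ge (Essential.card_le (hx ▸ hS))
    exact LinearMap.congr_fun (LinearMap.congr_fun h a.1) b.1
  | zero => exact map_zero _
  | add x y _ _ hx hy => exact (map_add (orbitCount R S) x.1 y.1).trans (by rw [hx, hy, add_zero])
  | smul r x _ hx => exact (map_smul (orbitCount R S) r x.1).trans (by rw [hx, smul_zero])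

end Factor

/-! ### Multiplication of the basis elements in the quotient algebra -/

section Quotient

variable (R : Type v) [CommRing R] {C G : Type u} [CommGroup C] [Group G] [Finite C] [Finite G]

/-- The class of the `C`-free part of `((G × G) × C) / S` in `RB_C^1(G × G)`. -/
def endCls (S : Subgroup ((G × G) × C)) : EndAlg R C G := freeCls R (GSet.coset S)

theorem endCls_mul {U V : Subgroup ((G × G) × C)} (hU : ∀ h, ∃ g c, ((g, h), c) ∈ U) :
    endCls R U * endCls R V = endCls R (star U V) := mcomp_freeCls_coset R U V hU

theorem endCls_diag : endCls R (diag C G) = 1 :=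
  Subtype.ext (freeCls_val_of_isFibred R unitSet_isFibred)

theorem endCls_val {S : Subgroup ((G × G) × C)} (hS : FibredSubgroup S) :
    (endCls R S).1 = cls R (GSet.coset S) := freeCls_val_of_isFibred R hS.isFibred

/-- The class of the `C`-free part of `((G × G) × C) / S` in the quotient algebra. -/
def hatCls (S : Subgroup ((G × G) × C)) : HatAlg R C G :=
  Ideal.Quotient.mkₐ R (factorIdeal R C G) (endCls R S)

theorem hatCls_eq_zero {S : Subgroup ((G × G) × C)} (h : ¬ Essential S) : hatCls R S = 0 :=
  Ideal.Quotient.eq_zero_iff_mem.2 (freeCls_mem_of_not_essential R h)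

theorem hatCls_mul {U V : Subgroup ((G × G) × C)} (hU : ∀ h, ∃ g c, ((g, h), c) ∈ U) :
    hatCls R U * hatCls R V = hatCls R (star U V) := by
  rw [hatCls, hatCls, ← map_mul, endCls_mul R hU, hatCls]

theorem hatCls_conj {S S' : Subgroup ((G × G) × C)} (g : (G × G) × C)
    (h : ∀ a, a ∈ S' ↔ g⁻¹ * a * g ∈ S) : hatCls R S' = hatCls R S :=
  congrArg (Ideal.Quotient.mkₐ R (factorIdeal R C G))
    (freeCls_iso R (GSet.coset_iso_of_conj g h))

/-- The subgroup of `(G × G) × C` attached to an element of `Ĝ`. -/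
def GHat.subgroup (x : GHat C G) : Subgroup ((G × G) × C) := graphSubgroup x.σ.out x.t

/-- The subgroup of `(G × G) × C` attached to an element of `𝒴_G`. -/
def YY.subgroup (y : YY C G) : Subgroup ((G × G) × C) := twistSubgroup y.ω.out y.ζ

/-- `GHat.subgroup` uses a chosen representative of the outer class. Any other gives a conjugate
subgroup, so products may be computed with arbitrary automorphisms. -/
theorem hatCls_subgroup_mk (w : MulAut G) (t : G →* C) :
    hatCls R (GHat.subgroup ⟨t, QuotientGroup.mk w⟩) = hatCls R (graphSubgroup w t) := by
  obtain ⟨g, hg⟩ := out_exists_conj (QuotientGroup.out_eq' (QuotientGroup.mk w : Out G)).symm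
  rw [GHat.subgroup]
  dsimp only
  rw [hg]
  exact hatCls_conj R _ (graph_conj_iff w t g)

theorem hatCls_yySubgroup_mk (w : MulAut G) (ζ : YSet C G) :
    hatCls R (YY.subgroup ⟨QuotientGroup.mk w, ζ⟩) = hatCls R (twistSubgroup w ζ) := by
  obtain ⟨g, hg⟩ := out_exists_conj (QuotientGroup.out_eq' (QuotientGroup.mk w : Out G)).symm
  rw [YY.subgroup]
  dsimp only
  rw [hg]
  exact hatCls_conj R _ (twist_conj_iff w ζ g)

omit [Finite C] [Finite G] in
theorem graphSubgroup_surj (w : MulAut G) (t : G →* C) (h : G) :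
    ∃ g c, ((g, h), c) ∈ graphSubgroup w t := ⟨w h, t h, rfl, rfl⟩

omit [Finite C] [Finite G] in
theorem twistSubgroup_surj (w : MulAut G) (ζ : YSet C G) (h : G) :
    ∃ g c, ((g, h), c) ∈ twistSubgroup w ζ := ⟨w h, 1, by simp [mem_twistSubgroup]⟩

theorem hatCls_graph_mul_graph (x y : GHat C G) :
    hatCls R x.subgroup * hatCls R y.subgroup = hatCls R (x * y).subgroup := by
  obtain ⟨t, σ⟩ := x
  obtain ⟨t', σ'⟩ := y
  induction σ using QuotientGroup.induction_on with | _ w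
  induction σ' using QuotientGroup.induction_on with | _ w'
  rw [hatCls_subgroup_mk, hatCls_subgroup_mk, hatCls_mul R (graphSubgroup_surj w t),
    star_graph_graph, ← hatCls_subgroup_mk]
  rfl

theorem hatCls_one : hatCls R (1 : GHat C G).subgroup = 1 := by
  have h : (1 : GHat C G) = ⟨1, QuotientGroup.mk 1⟩ := rfl
  rw [h, hatCls_subgroup_mk, ← diag_eq_graph, hatCls, endCls_diag, map_one]

variable [hC : Fact (Nat.card C).Prime]

theorem hatCls_graph_mul_twist (x : GHat C G) (y : YY C G) :
    hatCls R x.subgroup * hatCls R y.subgroup = hatCls R (YY.left x y).subgroup := by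
  obtain ⟨t, σ⟩ := x
  obtain ⟨ω, ζ⟩ := y
  induction σ using QuotientGroup.induction_on with | _ w
  induction ω using QuotientGroup.induction_on with | _ w'
  rw [hatCls_subgroup_mk, hatCls_yySubgroup_mk, hatCls_mul R (graphSubgroup_surj w t),
    star_graph_twist, ← hatCls_yySubgroup_mk]
  rfl

theorem hatCls_twist_mul_graph (y : YY C G) (x : GHat C G) :
    hatCls R y.subgroup * hatCls R x.subgroup = hatCls R (YY.right y x).subgroup := by
  obtain ⟨t, σ⟩ := x
  obtain ⟨ω, ζ⟩ := y
  induction σ using QuotientGroup.induction_on with | _ w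
  induction ω using QuotientGroup.induction_on with | _ w'
  rw [hatCls_subgroup_mk, hatCls_yySubgroup_mk, hatCls_mul R (twistSubgroup_surj w' ζ),
    star_twist_graph, ← hatCls_yySubgroup_mk]
  rfl

omit hC [Finite C] [Finite G] in
-- Through the middle pair `(χ(c), c)` the composite contains `(w(χ(c)) ζ(c)⁻¹, 1, 1)`; if it were
-- essential, this would be trivial for all `c`, that is `ζ = w ∘ χ`.
theorem not_essential_star_twist (w w' : MulAut G) {ζ χ : YSet C G} (h : ζ ≠ χ.aut w) :
    ¬ Essential (star (twistSubgroup w ζ) (twistSubgroup w' χ)) := by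
  refine fun hE => h (YSet.ext (MonoidHom.ext fun c => ?_))
  refine (mul_inv_eq_one.1 (hE.ker (w (χ.hom c) * (ζ.hom c)⁻¹) ⟨χ.hom c, c, ?_, ?_⟩)).symm
  · simp [mem_twistSubgroup]
  · simp [mem_twistSubgroup]

omit hC in
theorem hatCls_twist_mul_twist (y z : YY C G) :
    hatCls R y.subgroup * hatCls R z.subgroup =
      Finsupp.linearCombination R (fun y : YY C G => hatCls R y.subgroup) (YY.prod R y z) := by
  obtain ⟨ω, ζ⟩ := y
  obtain ⟨α, χ⟩ := z
  induction ω using QuotientGroup.induction_on with | _ w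
  induction α using QuotientGroup.induction_on with | _ w'
  rw [hatCls_yySubgroup_mk, hatCls_yySubgroup_mk, hatCls_mul R (twistSubgroup_surj w ζ), YY.prod]
  dsimp only
  rw [YSet.act_mk]
  split_ifs with h
  · rw [h, star_twist_twist, Finsupp.linearCombination_single, one_smul, ← QuotientGroup.mk_mul,
      hatCls_yySubgroup_mk]
  · rw [map_zero, hatCls_eq_zero R (not_essential_star_twist w w' h)]

end Quotient

/-! ### The isomorphism with the model algebra -/

section Model

variable (R : Type v) [CommRing R] {C G : Type u} [CommGroup C] [Group G] [Finite C] [Finite G]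

/-- The linear form on `RB_C^1(G × G)` counting the orbits that contain a point with
stabilizer `S`. -/
def endCount (S : Subgroup ((G × G) × C)) : EndAlg R C G →ₗ[R] R where
  toFun x := orbitCount R S x.1
  map_add' x y := map_add (orbitCount R S) x.1 y.1
  map_smul' r x := map_smul (orbitCount R S) r x.1

theorem endCount_endCls_self {S : Subgroup ((G × G) × C)} (hS : FibredSubgroup S) :
    endCount R S (endCls R S) = 1 := by
  change orbitCount R S (endCls R S).1 = 1
  rw [endCls_val R hS, orbitCount_cls, GSet.ncard_orbitsOfType_coset_self, Nat.cast_one]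

theorem endCount_endCls_of_not_conj {S T : Subgroup ((G × G) × C)} (hT : FibredSubgroup T)
    (h : ∀ g, ¬ ∀ a, a ∈ S ↔ g⁻¹ * a * g ∈ T) : endCount R S (endCls R T) = 0 := by
  change orbitCount R S (endCls R T).1 = 0
  rw [endCls_val R hT, orbitCount_cls, GSet.orbitsOfType_coset_eq_empty h, Set.ncard_empty,
    Nat.cast_zero]

theorem apply_linearCombination_eq {ι M : Type*} [AddCommGroup M] [Module R M] (φ : M →ₗ[R] R)
    (v : ι → M) (i : ι) (h1 : φ (v i) = 1) (h0 : ∀ j, j ≠ i → φ (v j) = 0) (f : ι →₀ R) :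
    φ (Finsupp.linearCombination R v f) = f i := by
  classical
  induction f using Finsupp.induction_linear with
  | zero => simp
  | add f g hf hg => simp [hf, hg]
  | single j r =>
    by_cases hj : j = i
    · subst hj; simp [h1]
    · simp [h0 j hj, hj]

theorem apply_linearCombination_eq_zero {ι M : Type*} [AddCommGroup M] [Module R M]
    (φ : M →ₗ[R] R) (v : ι → M) (h0 : ∀ j, φ (v j) = 0) (f : ι →₀ R) :
    φ (Finsupp.linearCombination R v f) = 0 := by
  induction f using Finsupp.induction_linear with
  | zero => simp
  | add f g hf hg => simp [hf, hg]
  | single j r => simp [h0 j]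

/-- The linear lift of the model to `RB_C^1(G × G)`. -/
def toEnd : HAlg R C G →ₗ[R] EndAlg R C G where
  toFun a := Finsupp.linearCombination R (fun y : YY C G => endCls R y.subgroup) a.y +
    Finsupp.linearCombination R (fun x : GHat C G => endCls R x.subgroup) a.g.coeff
  map_add' a b := by
    simp only [HAlg.add_y, HAlg.add_g, MonoidAlgebra.coeff_add, map_add]
    abel
  map_smul' r a := by
    simp only [HAlg.smul_y, HAlg.smul_g, MonoidAlgebra.coeff_smul, map_smul, smul_add,
      RingHom.id_apply]

theorem toEnd_apply (a : HAlg R C G) : toEnd R a =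
    Finsupp.linearCombination R (fun y : YY C G => endCls R y.subgroup) a.y +
      Finsupp.linearCombination R (fun x : GHat C G => endCls R x.subgroup) a.g.coeff := rfl

omit [Finite C] [Finite G] in
theorem GHat.eq_of_conj {x x' : GHat C G} {g : (G × G) × C}
    (h : ∀ a, a ∈ x.subgroup ↔ g⁻¹ * a * g ∈ x'.subgroup) : x = x' := by
  obtain ⟨h1, h2⟩ := eq_of_graph_conj h
  rw [QuotientGroup.out_eq', QuotientGroup.out_eq'] at h1
  exact GHat.ext h2 h1

omit [Finite C] [Finite G] in
theorem YY.eq_of_conj {y y' : YY C G} {g : (G × G) × C}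
    (h : ∀ a, a ∈ y.subgroup ↔ g⁻¹ * a * g ∈ y'.subgroup) : y = y' := by
  obtain ⟨h1, h2⟩ := eq_of_twist_conj h
  rw [QuotientGroup.out_eq', QuotientGroup.out_eq'] at h1
  exact YY.ext h1 h2

variable [hC : Fact (Nat.card C).Prime]

/-- The counting forms are dual to the chosen classes: distinct elements of `Ĝ` and `𝒴_G` have
non-conjugate subgroups, so each form reads off one coefficient. -/
theorem endCount_graph_toEnd (x : GHat C G) (a : HAlg R C G) :
    endCount R x.subgroup (toEnd R a) = a.g.coeff x := by
  rw [toEnd_apply, map_add, apply_linearCombination_eq_zero, zero_add, apply_linearCombination_eq]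
  · exact endCount_endCls_self R (fibred_graphSubgroup _ _)
  · exact fun x' hx => endCount_endCls_of_not_conj R (fibred_graphSubgroup _ _)
      fun g h => hx (GHat.eq_of_conj h).symm
  · exact fun y => endCount_endCls_of_not_conj R (fibred_twistSubgroup _ _)
      fun g => not_graph_conj_twist g

theorem endCount_twist_toEnd (y : YY C G) (a : HAlg R C G) :
    endCount R y.subgroup (toEnd R a) = a.y y := by
  rw [toEnd_apply, map_add, apply_linearCombination_eq, apply_linearCombination_eq_zero, add_zero]
  · exact fun x => endCount_endCls_of_not_conj R (fibred_graphSubgroup _ _)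
      fun g => not_twist_conj_graph g
  · exact endCount_endCls_self R (fibred_twistSubgroup _ _)
  · exact fun y' hy => endCount_endCls_of_not_conj R (fibred_twistSubgroup _ _)
      fun g h => hy (YY.eq_of_conj h).symm

/-- The linear map from the model to the quotient algebra. -/
def toHatLinear : HAlg R C G →ₗ[R] HatAlg R C G :=
  (Ideal.Quotient.mkₐ R (factorIdeal R C G)).toLinearMap ∘ₗ toEnd R

/-- If the image is zero, the lift to `RB_C^1(G × G)` lies in `I(G)`. There the forms of essential
subgroups vanish, and these forms are the coordinates. -/
theorem toHatLinear_injective : Function.Injective (toHatLinear R (C := C) (G := G)) := by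
  rw [injective_iff_map_eq_zero]
  intro a ha
  have h : toEnd R a ∈ factorSubmodule R C G := Ideal.Quotient.eq_zero_iff_mem.1 ha
  refine HAlg.ext ?_ ?_
  · ext y
    rw [← endCount_twist_toEnd]
    exact orbitCount_eq_zero_of_mem R (essential_twistSubgroup _ _) h
  · ext x
    rw [← endCount_graph_toEnd]
    exact orbitCount_eq_zero_of_mem R (essential_graphSubgroup _ _) h

theorem toHatLinear_apply (a : HAlg R C G) : toHatLinear R a =
    Finsupp.linearCombination R (fun y : YY C G => hatCls R y.subgroup) a.y +
      Finsupp.linearCombination R (fun x : GHat C G => hatCls R x.subgroup) a.g.coeff := by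
  change (Ideal.Quotient.mkₐ R (factorIdeal R C G)).toLinearMap (toEnd R a) = _
  rw [toEnd_apply, map_add, LinearMap.map_finsupp_linearCombination,
    LinearMap.map_finsupp_linearCombination]
  rfl

theorem hatCls_mem_range {S : Subgroup ((G × G) × C)} (hS : FibredSubgroup S) :
    hatCls R S ∈ LinearMap.range (toHatLinear R (C := C) (G := G)) := by
  by_cases hE : Essential S
  · rcases hE.eq_graph_or_twist hS with ⟨w, t, rfl⟩ | ⟨w, ζ, rfl⟩
    · refine ⟨⟨0, MonoidAlgebra.single ⟨t, QuotientGroup.mk w⟩ 1⟩, ?_⟩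
      simp [toHatLinear_apply, hatCls_subgroup_mk]
    · refine ⟨⟨Finsupp.single ⟨QuotientGroup.mk w, ζ⟩ 1, 0⟩, ?_⟩
      simp [toHatLinear_apply, hatCls_yySubgroup_mk]
  · rw [hatCls_eq_zero R hE]
    exact zero_mem _

/-- A fibred set is a sum of transitive sets with fibred stabilizers, and each such stabilizer is
either conjugate to a basis subgroup or has class zero in the quotient. -/
theorem toHatLinear_surjective : Function.Surjective (toHatLinear R (C := C) (G := G)) := by
  intro z
  obtain ⟨x, rfl⟩ := Ideal.Quotient.mkₐ_surjective R (factorIdeal R C G) z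
  let W : Submodule R (MonomialBurnside R C (G × G)) :=
    (LinearMap.range (toHatLinear R (C := C) (G := G))).comap
      (Ideal.Quotient.mkₐ R (factorIdeal R C G)).toLinearMap
  -- The decomposition into orbits takes place in the full Burnside group, so `W` is pushed forward
  -- there.
  have hW : MonomialBurnside R C (G × G) ≤ W.map (MonomialBurnside R C (G × G)).subtype := by
    refine Submodule.span_le.2 ?_
    rintro _ ⟨X, hX, rfl⟩
    refine cls_mem_of_stabilizer R _ X fun x => ?_
    have hf := hX.stabilizer x
    exact ⟨endCls R (MulAction.stabilizer ((G × G) × C) x), hatCls_mem_range R hf,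
      endCls_val R hf⟩
  obtain ⟨x', hx', h⟩ := hW x.2
  obtain rfl : x' = x := Subtype.ext h
  exact hx'

theorem toHatLinear_one : toHatLinear R (1 : HAlg R C G) = 1 := by
  rw [toHatLinear_apply, HAlg.one_y, HAlg.one_g, map_zero, zero_add, MonoidAlgebra.one_def,
    MonoidAlgebra.coeff_single, Finsupp.linearCombination_single, one_smul, hatCls_one]

/-- Both sides are bilinear, so each of the four blocks of the product is checked on basis elements,
by the product formulas for `hatCls`. -/
theorem toHatLinear_mul (a b : HAlg R C G) :
    toHatLinear R (a * b) = toHatLinear R a * toHatLinear R b := by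
  let Y : (YY C G →₀ R) →ₗ[R] HatAlg R C G :=
    Finsupp.linearCombination R fun y : YY C G => hatCls R y.subgroup
  let X : MonoidAlgebra R (GHat C G) →ₗ[R] HatAlg R C G :=
    (Finsupp.linearCombination R fun x : GHat C G => hatCls R x.subgroup) ∘ₗ
      (MonoidAlgebra.coeffLinearEquiv R).toLinearMap
  have hY (y : YY C G) : Y (Finsupp.single y 1) = hatCls R y.subgroup := by simp [Y]
  have hX (x : GHat C G) : X (MonoidAlgebra.single x 1) = hatCls R x.subgroup := by simp [X]
  have happ (a : HAlg R C G) : toHatLinear R a = Y a.y + X a.g := toHatLinear_apply R a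
  have hYY (f g : YY C G →₀ R) : Y (yMul R f g) = Y f * Y g := by
    have h : (yMul R).compr₂ Y = (LinearMap.mul R (HatAlg R C G)).compl₁₂ Y Y := by
      refine LinearMap.ext_on span_y ?_
      rintro _ ⟨y, rfl⟩
      refine LinearMap.ext_on span_y ?_
      rintro _ ⟨z, rfl⟩
      simp only [LinearMap.compr₂_apply, LinearMap.compl₁₂_apply, LinearMap.mul_apply',
        yMul_single, hY, mul_one, one_smul]
      exact (hatCls_twist_mul_twist R y z).symm
    exact LinearMap.congr_fun (LinearMap.congr_fun h f) g
  have hXY (f : MonoidAlgebra R (GHat C G)) (g : YY C G →₀ R) :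
      Y (yLeft R f g) = X f * Y g := by
    have h : (yLeft R).compr₂ Y = (LinearMap.mul R (HatAlg R C G)).compl₁₂ X Y := by
      refine LinearMap.ext_on span_g ?_
      rintro _ ⟨x, rfl⟩
      refine LinearMap.ext_on span_y ?_
      rintro _ ⟨y, rfl⟩
      simp only [LinearMap.compr₂_apply, LinearMap.compl₁₂_apply, LinearMap.mul_apply',
        yLeft_single, hX, hY, mul_one, hatCls_graph_mul_twist]
    exact LinearMap.congr_fun (LinearMap.congr_fun h f) g
  have hYX (f : YY C G →₀ R) (g : MonoidAlgebra R (GHat C G)) :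
      Y (yRight R f g) = Y f * X g := by
    have h : (yRight R).compr₂ Y = (LinearMap.mul R (HatAlg R C G)).compl₁₂ Y X := by
      refine LinearMap.ext_on span_y ?_
      rintro _ ⟨y, rfl⟩
      refine LinearMap.ext_on span_g ?_
      rintro _ ⟨x, rfl⟩
      simp only [LinearMap.compr₂_apply, LinearMap.compl₁₂_apply, LinearMap.mul_apply',
        yRight_single, hX, hY, mul_one, hatCls_twist_mul_graph]
    exact LinearMap.congr_fun (LinearMap.congr_fun h f) g
  have hXX (f g : MonoidAlgebra R (GHat C G)) : X (f * g) = X f * X g := by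
    have h : (LinearMap.mul R (MonoidAlgebra R (GHat C G))).compr₂ X =
        (LinearMap.mul R (HatAlg R C G)).compl₁₂ X X := by
      refine LinearMap.ext_on span_g ?_
      rintro _ ⟨x, rfl⟩
      refine LinearMap.ext_on span_g ?_
      rintro _ ⟨y, rfl⟩
      simp only [LinearMap.compr₂_apply, LinearMap.compl₁₂_apply, LinearMap.mul_apply',
        MonoidAlgebra.single_mul_single, hX, mul_one, hatCls_graph_mul_graph]
    exact LinearMap.congr_fun (LinearMap.congr_fun h f) g
  rw [happ, happ, happ, HAlg.mul_y, HAlg.mul_g, map_add, map_add, hYY, hXY, hYX, hXX, add_mul,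
    mul_add, mul_add]
  abel

variable (C G)

/-- The quotient algebra `RB_C^1(G × G) / I(G)` is isomorphic to `R𝒴_G ⊕ R Ĝ`. -/
def hAlgEquiv : HAlg R C G ≃ₐ[R] HatAlg R C G :=
  AlgEquiv.ofBijective
    (AlgHom.ofLinearMap (toHatLinear R) (toHatLinear_one R) (toHatLinear_mul R))
    ⟨toHatLinear_injective R, toHatLinear_surjective R⟩

omit [Finite C] [Finite G] hC in
theorem YSet.card_dvd_card_center (ζ : YSet C G) :
    Nat.card C ∣ Nat.card (Subgroup.center G) :=
  Subgroup.card_dvd_of_injective (ζ.hom.codRestrict (Subgroup.center G) fun c => (ζ.mem c).1)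
    fun _ _ h => ζ.injective (congrArg Subtype.val h)

/-- If `𝒴_G` is empty, then `R𝒴_G ⊕ R Ĝ` is the group algebra of `Ĝ`. -/
def hAlgEquivMonoidAlgebra [IsEmpty (YY C G)] :
    HAlg R C G ≃ₐ[R] MonoidAlgebra R (GHat C G) :=
  AlgEquiv.ofBijective
    (AlgHom.ofLinearMap
      { toFun := HAlg.g, map_add' := HAlg.add_g, map_smul' := HAlg.smul_g }
      HAlg.one_g HAlg.mul_g)
    ⟨fun _ _ h => HAlg.ext (Subsingleton.elim _ _) h, fun a => ⟨⟨0, a⟩, rfl⟩⟩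

end Model

end FibredBiset

end

theorem lemma2p7 (R : Type v) [CommRing R]
    (C : Type u) [CommGroup C] [Finite C] [Fact (Nat.card C).Prime]
    (G : Type u) [Group G] [Finite G] :
    (¬ Nat.card C ∣ Nat.card (Subgroup.center G) →
      Nonempty (FibredBiset.HatAlg R C G ≃ₐ[R] MonoidAlgebra R (FibredBiset.GHat C G))) ∧
    (Nat.card C ∣ Nat.card (Subgroup.center G) →
      Nonempty (FibredBiset.HatAlg R C G ≃ₐ[R] FibredBiset.HAlg R C G)) := by
  refine ⟨fun h => ?_, fun _ => ⟨(FibredBiset.hAlgEquiv R C G).symm⟩⟩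
  -- An element of `Y_G` embeds `C` in `Z(G)`, so by Lagrange none exists and the summand `R𝒴_G`
  -- disappears.
  have : IsEmpty (FibredBiset.YY C G) := ⟨fun y => h (y.ζ.card_dvd_card_center C G)⟩
  exact ⟨(FibredBiset.hAlgEquiv R C G).symm.trans (FibredBiset.hAlgEquivMonoidAlgebra R C G)⟩
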